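/- Let $V$ be a Euclidean space and let $R\subset V$ be the root system of a simple Lie algebra, i.e. an irreducible reduced crystallographic root system spanning $V$, whose Weyl group $W$ (generated by the reflections $s_\alpha$, $\alpha\in R$) acts by orthogonal transformations. Assume that $R$ is not of type $A_1$ or $B_2$. Let $R_+\subset R$ be the set of positive roots with respect to a linear form on $V$ that vanishes on no root. Let $U\subset\mathbb C$ be a connected open neighbourhood of $0$, and let $(f_\alpha)_{\alpha\in R}$ be meromorphic functions on $U$, none of them identically zero, such that $f_{-\alpha}(z)=-f_\alpha(-z)$ near $0$ for all $\alpha\in R$, and which are $W$-invariant: $f_{w\alpha}=f_\alpha$ for all $w\in W$, $\alpha\in R$. Suppose that they solve the functional equations $$\sum_{\alpha,\beta\in R_+:\ s_\alpha s_\beta=r}\langle\alpha,\beta\rangle\, f_\alpha\big((\alpha,x)\big)\,f_\beta\big((s_\alpha(\beta),x)\big)=0 \qquad (8)$$ for every rotation $r$, where the identity is required for all $x$ in some neighbourhood of $0$ in $V$ with $(\gamma,x)\ne0$ for all $\gamma\in R$. Here $\langle\alpha,\beta\rangle$ is the oriented area of the parallelogram with sides $\alpha,\beta$ with respect to an orientation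 of the plane orthogonal to the fixed space of $r$ (equation (8) does not depend on this orientation). Then there is a $W$-invariant function $\alpha\mapsto k_\alpha\in\mathbb C$ on $R$ such that, as meromorphic functions on $U$, $$f_\alpha(z)=\frac{k_\alpha}{z}\qquad\text{for all }\alpha\in R .$$ -/

import Mathlib

open Filter Topology

noncomputable section

namespace GeneralizedDunkl

variable {ι V N : Type*} [NormedAddCommGroup V] [InnerProductSpace ℝ V]
  [AddCommGroup N] [Module ℝ N]

/-- The Weyl group acts on the Euclidean space `V` by orthogonal transformations. -/
def IsOrthogonal (P : RootPairing ι ℝ V N) : Prop :=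
  ∀ (i : ι) (x y : V), inner ℝ (P.reflection i x) (P.reflection i y) = inner ℝ x y

/-- The root system has type `A₁`: it is `{α, -α}`. -/
def IsTypeA₁ (P : RootPairing ι ℝ V N) : Prop :=
  ∃ α : V, Set.range P.root = {α, -α}

/-- The root system has type `B₂`: it is `{± e₁, ± e₂, ± e₁ ± e₂}` for two orthogonal vectors
`e₁`, `e₂` of the same length. -/
def IsTypeB₂ (P : RootPairing ι ℝ V N) : Prop :=
  ∃ e₁ e₂ : V, inner ℝ e₁ e₂ = 0 ∧ ‖e₁‖ = ‖e₂‖ ∧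
    Set.range P.root = {e₁, -e₁, e₂, -e₂, e₁ + e₂, -e₁ - e₂, e₁ - e₂, -e₁ + e₂}

/-- The oriented area of the parallelogram with sides `a`, `b` in the plane with positively
oriented orthonormal basis `e₁`, `e₂`. -/
def orientedArea (e₁ e₂ a b : V) : ℝ :=
  inner ℝ a e₁ * inner ℝ b e₂ - inner ℝ a e₂ * inner ℝ b e₁

/-- The plane orthogonal to the rotation axis `{x | r x = x}` of `r` has the orthonormal
basis `e₁`, `e₂`. -/
def IsRotationPlaneBasis (r : V ≃ₗ[ℝ] V) (e₁ e₂ : V) : Prop :=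
  Orthonormal ℝ ![e₁, e₂] ∧
    Submodule.span ℝ {e₁, e₂} = (LinearMap.ker ((r : V →ₗ[ℝ] V) - LinearMap.id))ᗮ

open Classical in
/-- The pairs `(α, β)` of positive roots with `s_α s_β = r`, where a root is positive if the
linear form `ℓ` is positive on it. -/
def rotationPairs [Fintype ι] (P : RootPairing ι ℝ V N) (ℓ : V →ₗ[ℝ] ℝ) (r : V ≃ₗ[ℝ] V) :
    Finset (ι × ι) :=
  Finset.univ.filter fun p ↦ 0 < ℓ (P.root p.1) ∧ 0 < ℓ (P.root p.2) ∧
    P.reflection p.1 * P.reflection p.2 = r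

/-- The functional equations
`∑_{α, β > 0, s_α s_β = r} ⟨α, β⟩ f_α((α, x)) f_β((s_α β, x)) = 0`, one for each rotation `r`
(and for either orientation of its plane), as identities between functions that are meromorphic
near the origin: they hold for all `x` near `0` outside the reflection hyperplanes. -/
def SolvesFunctionalEquations [Fintype ι] (P : RootPairing ι ℝ V N) (ℓ : V →ₗ[ℝ] ℝ)
    (f : ι → ℂ → ℂ) : Prop :=
  ∀ (r : V ≃ₗ[ℝ] V) (e₁ e₂ : V), IsRotationPlaneBasis r e₁ e₂ →
    ∀ᶠ x in 𝓝 (0 : V), (∀ i, inner ℝ (P.root i) x ≠ 0) →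
      ∑ p ∈ rotationPairs P ℓ r,
        (orientedArea e₁ e₂ (P.root p.1) (P.root p.2) : ℂ) *
          f p.1 ((inner ℝ (P.root p.1) x : ℝ) : ℂ) *
          f p.2 ((inner ℝ (P.reflection p.1 (P.root p.2)) x : ℝ) : ℂ) = 0

end GeneralizedDunkl

end

/-! Since `s_α` sends `α` to `-α`, invariance and the sign rule make every `f_α` odd. By the
identity theorem it is enough to know the germs at `0` along the real line. All roots occurring in
the equation of a rotation lie in its plane, and moving `x` orthogonally to that plane avoids the
other hyperplanes. Each equation is therefore an identity in two free real variables for a rank two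
subsystem; `IsInvariantSolution.sum_rotationSeq_eq_zero` writes it out along a sequence that lists
the lines of roots of the plane.

Type A₂: there is one function `F`, and at a point where the roots take the values `t`, `2t`, `t`
the equation reads `F(t) (2 F(2t) - F(t)) = 0`. A meromorphic germ with `2 F(2t) = F(t)` is a
multiple of `1/t`. Type B₂: the equation is used only to transfer information; if one of the two
functions is a nonzero multiple of `1/t`, a suitable evaluation gives the same doubling relation for
the other.

Outside G₂, the property of being a multiple of `1/t` thus passes between non-orthogonal roots, and
holds for a root with a non-orthogonal, non-proportional root of equal length. If it fails for some
root, all roots must lie in one plane, and only B₂ is left.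

Type G₂ has a short function `F` and a long function `G`. Letting one root value tend to `0` in the
equations for the rotations by `π/3` and `2π/3` bounds the poles by order one, and gives three
one-variable equations for `u = x F` and `v = x G`, hence a recursion on Taylor coefficients. At the
first order `m > 0` where a coefficient could be nonzero the recursion is linear and forces `(3m - 1
+ 2^m)² = 3^(m+2)`, so `m` is 2, 4 or 6. In these three cases the quadratic terms at order `2m` give
a contradiction, so `u` and `v` are constant. -/

open Finset.HasAntidiagonal

/-! ### Coefficient sequences with a gap, and the recursion for G₂ -/

theorem sum_antidiagonal_of_gap {x y : ℕ → ℂ} {m : ℕ} (hm : 0 < m)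
    (hx : ∀ i, 0 < i → i < m → x i = 0) :
    ∑ p ∈ antidiagonal m, x p.1 * y p.2 = x 0 * y m + x m * y 0 := by
  rw [← Finset.sum_subset (s₁ := {(0, m), (m, 0)})]
  · rw [Finset.sum_pair (by simp; omega)]
  · intro p hp
    simp only [Finset.mem_insert, Finset.mem_singleton] at hp
    rcases hp with rfl | rfl <;> simp
  · rintro ⟨i, j⟩ hp hn
    simp only [mem_antidiagonal, Finset.mem_insert, Finset.mem_singleton,
      Prod.mk.injEq, not_or] at hp hn
    rw [hx i (by omega) (by omega), zero_mul]

/-- In a pair summing to `2m`, unless it is `(0, 2m)`, `(m, m)` or `(2m, 0)`, one entry lies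
strictly between `0` and `m`. The middle term is the quadratic contribution that decides the
resonant orders. -/
theorem sum_antidiagonal_two_mul_of_gap {x y : ℕ → ℂ} {m : ℕ} (hm : 0 < m)
    (hx : ∀ i, 0 < i → i < m → x i = 0) (hy : ∀ i, 0 < i → i < m → y i = 0) :
    ∑ p ∈ antidiagonal (2 * m), x p.1 * y p.2 =
      x 0 * y (2 * m) + x m * y m + x (2 * m) * y 0 := by
  rw [← Finset.sum_subset (s₁ := {(0, 2 * m), (m, m), (2 * m, 0)})]
  · rw [Finset.sum_insert (by simp; omega), Finset.sum_pair (by simp; omega), add_assoc]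
  · intro p hp
    simp only [Finset.mem_insert, Finset.mem_singleton] at hp
    rcases hp with rfl | rfl | rfl <;> simp; omega
  · rintro ⟨i, j⟩ hp hn
    simp only [mem_antidiagonal, Finset.mem_insert, Finset.mem_singleton,
      Prod.mk.injEq, not_or] at hp hn
    rcases lt_or_ge i m with h | h
    · rw [hx i (by omega) h, zero_mul]
    · rw [hy j (by omega) (by omega), mul_zero]

theorem sum_antidiagonal_of_vanishing {x y : ℕ → ℂ} {n : ℕ} (hy : ∀ i < n, y i = 0) :
    ∑ p ∈ antidiagonal n, x p.1 * y p.2 = x 0 * y n := by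
  rw [← Finset.sum_subset (s₁ := {(0, n)})]
  · simp
  · simp
  · rintro ⟨i, j⟩ hp hn
    simp only [mem_antidiagonal, Finset.mem_singleton, Prod.mk.injEq] at hp hn
    rw [hy j (by omega), mul_zero]

theorem eq_two_or_four_or_six_of_resonance {m : ℕ} (hm : 0 < m)
    (h : (3 * (m : ℤ) - 1 + 2 ^ m) ^ 2 = 3 ^ (m + 2)) : m = 2 ∨ m = 4 ∨ m = 6 := by
  have hlt : m < 7 := by
    by_contra hc
    push Not at hc
    have key : ∀ n : ℕ, 7 ≤ n → (3 : ℤ) ^ (n + 2) < (3 * (n : ℤ) - 1 + 2 ^ n) ^ 2 := by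
      intro n hn
      rcases eq_or_lt_of_le hn with rfl | hn
      · norm_num
      -- The comparison `9 · 3^k ≤ 4^k` starts only at `k = 8`, so `7` is checked by hand; there the
      -- linear term is needed.
      have h4 : ∀ k : ℕ, 8 ≤ k → (3 : ℤ) ^ (k + 2) ≤ (2 ^ k) ^ 2 := by
        intro k hk
        induction k, hk using Nat.le_induction with
        | base => norm_num
        | succ k hk ih =>
          rw [pow_succ 2 k, mul_pow, show k + 1 + 2 = (k + 2) + 1 by ring, pow_succ]
          nlinarith [sq_nonneg ((2:ℤ) ^ k)]
      have h5 := h4 n hn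
      have h6 : (0 : ℤ) < 2 ^ n := by positivity
      have h7 : (8 : ℤ) ≤ n := by exact_mod_cast hn
      nlinarith
    have := key m hc
    omega
  interval_cases m <;> simp_all

/-- The coefficient form of the three one-variable equations satisfied by the series
`u = ∑ aₙ zⁿ` and `v = ∑ bₙ zⁿ` attached to a root system of type `G₂`. -/
structure G2Recursion (a b : ℕ → ℂ) : Prop where
  short (n : ℕ) : 3 * a 0 * ((n - 1) * b n) +
    ∑ p ∈ antidiagonal n, a p.1 * ((2 + 2 ^ p.2) * b p.2) = 0
  long (n : ℕ) : 3 * b 0 * ((n - 1) * a n) +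
    ∑ p ∈ antidiagonal n, (3 ^ p.1 * b p.1) * ((2 + 2 ^ p.2) * a p.2) = 0
  mixed (n : ℕ) : a 0 * ((n - 1) * a n) + ∑ p ∈ antidiagonal n, a p.1 * a p.2 =
    3 * ∑ p ∈ antidiagonal n, b p.1 * ((1 - 2 ^ p.2) * b p.2)

namespace G2Recursion

variable {a b : ℕ → ℂ}

theorem coeff_ne_zero (n : ℕ) (hn : 0 < n) : 3 * ((n : ℂ) - 1) + (2 + 2 ^ n) ≠ 0 := by
  have h1 : 3 * ((n : ℂ) - 1) + (2 + 2 ^ n) = ((3 * (n - 1) + 2 + 2 ^ n : ℕ) : ℂ) := by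
    push_cast [Nat.cast_sub (show 1 ≤ n from hn)]
    ring
  rw [h1, Nat.cast_ne_zero]
  positivity

/-- If both residues vanish, the short equation is a vanishing product of two power series, which is
impossible in a domain. If exactly one vanishes, induction in the equation led by the other kills
the whole series, because `3(n - 1) + 2 + 2^n` is positive for `n > 0`. -/
theorem zero_ne_zero (h : G2Recursion a b) (ha : ∃ n, a n ≠ 0) (hb : ∃ n, b n ≠ 0) :
    a 0 ≠ 0 ∧ b 0 ≠ 0 := by
  by_cases hp : a 0 = 0 <;> by_cases hq : b 0 = 0
  · exfalso
    have hmul : PowerSeries.mk a * PowerSeries.mk (fun n ↦ (2 + 2 ^ n) * b n) = 0 := by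
      ext n
      simpa [PowerSeries.coeff_mul, hp] using h.short n
    obtain ⟨n, hn⟩ := ha
    obtain ⟨m, hm⟩ := hb
    rcases mul_eq_zero.mp hmul with h0 | h0
    · exact hn (by simpa using congrArg (PowerSeries.coeff n) h0)
    · have h1 : (2 + 2 ^ m) * b m = 0 := by simpa using congrArg (PowerSeries.coeff m) h0
      have h2 : (2 + 2 ^ m : ℂ) ≠ 0 := by
        have : (2 + 2 ^ m : ℂ) = ((2 + 2 ^ m : ℕ) : ℂ) := by push_cast; ring
        rw [this, Nat.cast_ne_zero]
        positivity
      exact hm ((mul_eq_zero.mp h1).resolve_left h2)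
  · exfalso
    obtain ⟨n, hn⟩ := ha
    refine hn ?_
    induction n using Nat.strong_induction_on with
    | _ n ih =>
      rcases Nat.eq_zero_or_pos n with rfl | hpos
      · exact hp
      have h0 : ∀ i < n, a i = 0 := fun i hi ↦ by
        by_contra hne
        exact hne (ih i hi hne)
      have h1 := h.long n
      rw [sum_antidiagonal_of_vanishing (x := fun i ↦ 3 ^ i * b i)
        (y := fun i ↦ (2 + 2 ^ i) * a i) fun i hi ↦ by simp [h0 i hi]] at h1
      have h2 : b 0 * (3 * ((n : ℂ) - 1) + (2 + 2 ^ n)) * a n = 0 := by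
        linear_combination h1
      simpa [hq, coeff_ne_zero n hpos] using h2
  · exfalso
    obtain ⟨n, hn⟩ := hb
    refine hn ?_
    induction n using Nat.strong_induction_on with
    | _ n ih =>
      rcases Nat.eq_zero_or_pos n with rfl | hpos
      · exact hq
      have h0 : ∀ i < n, b i = 0 := fun i hi ↦ by
        by_contra hne
        exact hne (ih i hi hne)
      have h1 := h.short n
      rw [sum_antidiagonal_of_vanishing (y := fun i ↦ (2 + 2 ^ i) * b i)
        fun i hi ↦ by simp [h0 i hi]] at h1
      have h2 : a 0 * (3 * ((n : ℂ) - 1) + (2 + 2 ^ n)) * b n = 0 := by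
        linear_combination h1
      simpa [hp, coeff_ne_zero n hpos] using h2
  · exact ⟨hp, hq⟩

/-- The three equations at order `m` are linear in `(a m, b m)`; the first two are dependent only at
a resonance. There the mixed equation fixes `a 0 ^ 2 = b 0 ^ 2`, and order `2m` gives three
equations for the two new unknowns, whose elimination leaves a nonzero multiple of `a 0 * b m ^ 2`.
-/
theorem eq_zero_of_gap (h : G2Recursion a b) (hp : a 0 ≠ 0) (hq : b 0 ≠ 0) {m : ℕ} (hm : 0 < m)
    (ha : ∀ i, 0 < i → i < m → a i = 0) (hb : ∀ i, 0 < i → i < m → b i = 0) :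
    a m = 0 ∧ b m = 0 := by
  have e1 := h.short m
  have e2 := h.long m
  have e3 := h.mixed m
  rw [sum_antidiagonal_of_gap (y := fun i ↦ (2 + 2 ^ i) * b i) hm ha] at e1
  rw [sum_antidiagonal_of_gap (x := fun i ↦ 3 ^ i * b i) (y := fun i ↦ (2 + 2 ^ i) * a i) hm
    fun i h0 h1 ↦ by simp [hb i h0 h1]] at e2
  rw [sum_antidiagonal_of_gap hm ha,
    sum_antidiagonal_of_gap (y := fun i ↦ (1 - 2 ^ i) * b i) hm hb] at e3
  have f1 := h.short (2 * m)
  have f2 := h.long (2 * m)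
  have f3 := h.mixed (2 * m)
  rw [sum_antidiagonal_two_mul_of_gap (y := fun i ↦ (2 + 2 ^ i) * b i) hm ha
    fun i h0 h1 ↦ by simp [hb i h0 h1]] at f1
  rw [sum_antidiagonal_two_mul_of_gap (x := fun i ↦ 3 ^ i * b i)
    (y := fun i ↦ (2 + 2 ^ i) * a i) hm (fun i h0 h1 ↦ by simp [hb i h0 h1])
    fun i h0 h1 ↦ by simp [ha i h0 h1]] at f2
  rw [sum_antidiagonal_two_mul_of_gap hm ha ha,
    sum_antidiagonal_two_mul_of_gap (y := fun i ↦ (1 - 2 ^ i) * b i) hm hb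
    fun i h0 h1 ↦ by simp [hb i h0 h1]] at f3
  have g1 : 3 * b 0 * a m = -(3 * m - 1 + 2 ^ m) * a 0 * b m := by
    linear_combination e1
  by_cases hbm : b m = 0
  · refine ⟨?_, hbm⟩
    rw [hbm, mul_zero] at g1
    simpa [hq] using g1
  exfalso
  -- Eliminating `a m` between the short and the long equation.
  have hres : ((3 * (m : ℂ) - 1 + 2 ^ m) ^ 2) = 3 ^ (m + 2) := by
    have hz : a 0 * b m * ((3 * (m : ℂ) - 1 + 2 ^ m) ^ 2 - 3 ^ (m + 2)) = 0 := by
      linear_combination (3 * (m : ℂ) - 1 + 2 ^ m) * g1 - 3 * e2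
    have := (mul_eq_zero.mp hz).resolve_left (mul_ne_zero hp hbm)
    linear_combination this
  have hcases := eq_two_or_four_or_six_of_resonance hm (by exact_mod_cast hres)
  rcases hcases with rfl | rfl | rfl <;> push_cast at e3 f1 f2 f3 g1
  · have hpq : a 0 ^ 2 = b 0 ^ 2 := by
      refine mul_right_cancel₀ hbm ?_
      linear_combination -1/27 * (3 * b 0 * e3 - 3 * a 0 * g1)
    have hsq : a 2 ^ 2 = 9 * b 2 ^ 2 := by
      refine mul_left_cancel₀ (pow_ne_zero 2 hp) ?_
      linear_combination a 2 ^ 2 * hpq + 1/9 * (3 * b 0 * a 2 - 9 * a 0 * b 2) * g1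
    -- The multipliers of `f1`, `f2`, `f3`, here and in the next two cases, cancel `a (2m)` and `b
    -- (2m)`, using `a 0 ^ 2 = b 0 ^ 2`. For `m = 2` the long equation is superfluous, because order
    -- `4` is itself resonant.
    have hz : (-144) * (a 0 * b 2 ^ 2) = 0 := by
      linear_combination 5 * b 0 * f1 + 0 * b 0 * f2 + -3 * a 0 * f3
        + 15 * a (2 * 2) * hpq - 30 / 3 * b 2 * g1
        - -3 * a 0 * hsq
    simp [hp, hbm] at hz
  · have hpq : a 0 ^ 2 = b 0 ^ 2 := by
      refine mul_right_cancel₀ hbm ?_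
      linear_combination -1/135 * (3 * b 0 * e3 - 5 * a 0 * g1)
    have hsq : a 4 ^ 2 = 81 * b 4 ^ 2 := by
      refine mul_left_cancel₀ (pow_ne_zero 2 hp) ?_
      linear_combination a 4 ^ 2 * hpq + 1/9 * (3 * b 0 * a 4 - 27 * a 0 * b 4) * g1
    have hz : 51300 * (a 0 * b 4 ^ 2) = 0 := by
      linear_combination -168 * b 0 * f1 + -1 * b 0 * f2 + 87 * a 0 * f3
        + -783 * a (2 * 4) * hpq - -4482 / 3 * b 4 * g1
        - 87 * a 0 * hsq
    simp [hp, hbm] at hz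
  · have hpq : a 0 ^ 2 = b 0 ^ 2 := by
      refine mul_right_cancel₀ hbm ?_
      linear_combination -1/567 * (3 * b 0 * e3 - 7 * a 0 * g1)
    have hsq : a 6 ^ 2 = 729 * b 6 ^ 2 := by
      refine mul_left_cancel₀ (pow_ne_zero 2 hp) ?_
      linear_combination a 6 ^ 2 * hpq + 1/9 * (3 * b 0 * a 6 - 81 * a 0 * b 6) * g1
    have hz : 5143824 * (a 0 * b 6 ^ 2) = 0 := by
      linear_combination -1782 * b 0 * f1 + -1 * b 0 * f2 + 729 * a 0 * f3
        + -9477 * a (2 * 6) * hpq - -165726 / 3 * b 6 * g1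
        - 729 * a 0 * hsq
    simp [hp, hbm] at hz

theorem eq_zero (h : G2Recursion a b) (ha : ∃ n, a n ≠ 0) (hb : ∃ n, b n ≠ 0) (n : ℕ)
    (hn : 0 < n) : a n = 0 ∧ b n = 0 := by
  obtain ⟨hp, hq⟩ := h.zero_ne_zero ha hb
  induction n using Nat.strong_induction_on with
  | _ n ih =>
    exact h.eq_zero_of_gap hp hq hn (fun i h0 h1 ↦ (ih i h1 h0).1) fun i h0 h1 ↦ (ih i h1 h0).2

end G2Recursion

/-! ### Taylor coefficients of complex functions of a real variable -/

/-- The `n`-th Taylor coefficient at the origin. -/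
noncomputable def taylorCoeff (u : ℝ → ℂ) (n : ℕ) : ℂ := iteratedDeriv n u 0 / n.factorial

section TaylorCoeff

variable {u v : ℝ → ℂ}

theorem taylorCoeff_congr (h : u =ᶠ[𝓝 0] v) (n : ℕ) : taylorCoeff u n = taylorCoeff v n := by
  rw [taylorCoeff, taylorCoeff, h.iteratedDeriv_eq n]

theorem taylorCoeff_zero_right (u : ℝ → ℂ) : taylorCoeff u 0 = u 0 := by
  simp [taylorCoeff]

theorem taylorCoeff_fun_zero (n : ℕ) : taylorCoeff (fun _ ↦ 0) n = 0 := by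
  cases n <;> simp [taylorCoeff]

theorem taylorCoeff_add (hu : AnalyticAt ℝ u 0) (hv : AnalyticAt ℝ v 0) (n : ℕ) :
    taylorCoeff (fun x ↦ u x + v x) n = taylorCoeff u n + taylorCoeff v n := by
  rw [taylorCoeff, iteratedDeriv_fun_add hu.contDiffAt hv.contDiffAt, add_div, taylorCoeff,
    taylorCoeff]

theorem taylorCoeff_mul (hu : AnalyticAt ℝ u 0) (hv : AnalyticAt ℝ v 0) (n : ℕ) :
    taylorCoeff (fun x ↦ u x * v x) n =
      ∑ p ∈ antidiagonal n, taylorCoeff u p.1 * taylorCoeff v p.2 := by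
  rw [taylorCoeff, iteratedDeriv_fun_mul hu.contDiffAt hv.contDiffAt,
    Finset.Nat.sum_antidiagonal_eq_sum_range_succ
      (fun i j ↦ taylorCoeff u i * taylorCoeff v j), Finset.sum_div]
  refine Finset.sum_congr rfl fun i hi ↦ ?_
  have hi' : i ≤ n := Nat.lt_succ_iff.mp (Finset.mem_range.mp hi)
  have h1 := Nat.choose_mul_factorial_mul_factorial hi'
  have h2 : (n.factorial : ℂ) = n.choose i * i.factorial * (n - i).factorial := by
    rw [← h1]; push_cast; ring
  have h3 : ((n.choose i : ℕ) : ℂ) ≠ 0 := Nat.cast_ne_zero.mpr (Nat.choose_pos hi').ne'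
  have h4 : ((i.factorial : ℕ) : ℂ) ≠ 0 := Nat.cast_ne_zero.mpr (Nat.factorial_ne_zero _)
  have h5 : (((n - i).factorial : ℕ) : ℂ) ≠ 0 := Nat.cast_ne_zero.mpr (Nat.factorial_ne_zero _)
  rw [taylorCoeff, taylorCoeff, h2]
  field_simp

theorem taylorCoeff_const_mul (c : ℂ) (hu : AnalyticAt ℝ u 0) (n : ℕ) :
    taylorCoeff (fun x ↦ c * u x) n = c * taylorCoeff u n := by
  rw [taylorCoeff, iteratedDeriv_const_mul c hu.contDiffAt, taylorCoeff, mul_div_assoc]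

theorem iteratedDeriv_comp_mul_left (u : ℝ → ℂ) (c : ℝ) (n : ℕ) :
    iteratedDeriv n (fun x ↦ u (c * x)) = fun x ↦ c ^ n • iteratedDeriv n u (c * x) := by
  induction n with
  | zero => simp
  | succ n ih =>
    ext x
    rw [iteratedDeriv_succ, ih, iteratedDeriv_succ]
    have h1 := deriv_const_smul_field (x := x) (c ^ n) (fun y ↦ iteratedDeriv n u (c * y))
    rw [Pi.smul_def] at h1
    rw [h1, deriv_comp_mul_left, smul_smul, pow_succ]

theorem taylorCoeff_comp_mul_left (u : ℝ → ℂ) (c : ℝ) (n : ℕ) :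
    taylorCoeff (fun x ↦ u (c * x)) n = c ^ n * taylorCoeff u n := by
  rw [taylorCoeff, iteratedDeriv_comp_mul_left, taylorCoeff]
  simp [mul_div_assoc]

theorem taylorCoeff_ofReal (n : ℕ) :
    taylorCoeff (fun x ↦ (x : ℂ)) n = if n = 1 then 1 else 0 := by
  have h : ∀ n, iteratedDeriv (n + 2) (fun x : ℝ ↦ (x : ℂ)) = fun _ ↦ 0 := fun n ↦ by
    have h1 : deriv (fun x : ℝ ↦ (x : ℂ)) = fun _ ↦ 1 := by
      ext x
      exact Complex.ofRealCLM.hasDerivAt.deriv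
    ext x
    rw [iteratedDeriv_succ', h1, iteratedDeriv_const]
    simp
  match n with
  | 0 => simp [taylorCoeff]
  | 1 =>
    have h1 : deriv (fun x : ℝ ↦ (x : ℂ)) 0 = 1 := Complex.ofRealCLM.hasDerivAt.deriv
    simp [taylorCoeff, h1]
  | n + 2 => simp [taylorCoeff, h]

theorem taylorCoeff_id_mul_deriv (hu : AnalyticAt ℝ u 0) (n : ℕ) :
    taylorCoeff (fun x ↦ x * deriv u x) n = n * taylorCoeff u n := by
  have hid : AnalyticAt ℝ (fun x : ℝ ↦ (x : ℂ)) 0 := Complex.ofRealCLM.analyticAt 0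
  rw [taylorCoeff_mul hid hu.deriv]
  cases n with
  | zero => simp [taylorCoeff_ofReal]
  | succ n =>
    rw [Finset.Nat.antidiagonal_succ, Finset.sum_cons, Finset.sum_map]
    have h0 : ∀ p ∈ antidiagonal n, p ≠ (0, n) → taylorCoeff (fun x ↦ (x : ℂ)) (p.1 + 1) *
        taylorCoeff (deriv u) p.2 = 0 := by
      rintro ⟨i, j⟩ hp hne
      have : i ≠ 0 := by
        rintro rfl
        simp_all
      simp [taylorCoeff_ofReal, this]
    have h1 := Finset.sum_eq_single_of_mem (f := fun p : ℕ × ℕ ↦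
      taylorCoeff (fun x ↦ (x : ℂ)) (p.1 + 1) * taylorCoeff (deriv u) p.2) (0, n) (by simp) h0
    refine (congrArg (_ + ·) h1).trans ?_
    simp only [taylorCoeff_ofReal]
    simp only [taylorCoeff, iteratedDeriv_succ', Nat.factorial_succ]
    push_cast
    have h2 : (n.factorial : ℂ) ≠ 0 := Nat.cast_ne_zero.mpr n.factorial_ne_zero
    have h3 : (n : ℂ) + 1 ≠ 0 := Nat.cast_add_one_ne_zero n
    simp
    field_simp

theorem AnalyticAt.eventually_eq_const_of_taylorCoeff (hu : AnalyticAt ℝ u 0)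
    (h : ∀ n, 0 < n → taylorCoeff u n = 0) : ∀ᶠ x in 𝓝 0, u x = u 0 := by
  have h1 : AnalyticAt ℝ (fun x ↦ u x + -u 0) 0 := hu.fun_add analyticAt_const
  have h2 : ∀ n : ℕ, n ≤ analyticOrderAt (fun x ↦ u x + -u 0) 0 := fun n ↦ by
    rw [natCast_le_analyticOrderAt_iff_iteratedDeriv_eq_zero h1]
    intro i _
    have h3 := taylorCoeff_add hu analyticAt_const (v := fun _ ↦ -u 0) i
    have h4 : taylorCoeff (fun x ↦ u x + -u 0) i = 0 := by
      rw [h3]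
      rcases Nat.eq_zero_or_pos i with rfl | hi
      · simp [taylorCoeff_zero_right]
      · rw [h i hi, taylorCoeff, iteratedDeriv_const]
        simp [hi.ne']
    simpa [taylorCoeff, Nat.factorial_ne_zero] using h4
  have h3 := analyticOrderAt_eq_top.mp (ENat.eq_top_iff_forall_ge.mpr h2)
  filter_upwards [h3] with x hx
  linear_combination hx

theorem AnalyticAt.exists_taylorCoeff_ne_zero (hu : AnalyticAt ℝ u 0)
    (h : ¬ ∀ᶠ x in 𝓝 0, u x = 0) : ∃ n, taylorCoeff u n ≠ 0 := by
  by_contra! hc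
  refine h ?_
  filter_upwards [hu.eventually_eq_const_of_taylorCoeff fun n _ ↦ hc n] with x hx
  rw [hx, ← taylorCoeff_zero_right u, hc]

end TaylorCoeff

theorem AnalyticAt.comp_mul_left {u : ℝ → ℂ} (hu : AnalyticAt ℝ u 0) (c : ℝ) :
    AnalyticAt ℝ (fun x ↦ u (c * x)) 0 :=
  AnalyticAt.fun_comp (by simpa using hu) (analyticAt_const.fun_mul analyticAt_id)

/-- On the `n`-th coefficient the operator `x d/dx` acts as `n` and the dilation by `c` as `c^n`, so
the differential-difference equations become the recursion. -/
theorem g2Recursion_taylorCoeff {u v : ℝ → ℂ} (hu : AnalyticAt ℝ u 0) (hv : AnalyticAt ℝ v 0)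
    (h1 : ∀ᶠ x in 𝓝 (0 : ℝ), 3 * u 0 * (x * deriv v x - v x) + u x * (2 * v x + v (2 * x)) = 0)
    (h2 : ∀ᶠ x in 𝓝 (0 : ℝ),
      3 * v 0 * (x * deriv u x - u x) + v (3 * x) * (2 * u x + u (2 * x)) = 0)
    (h3 : ∀ᶠ x in 𝓝 (0 : ℝ), u 0 * (x * deriv u x - u x) + u x * u x =
      3 * (v x * (v x - v (2 * x)))) :
    G2Recursion (taylorCoeff u) (taylorCoeff v) := by
  have hid : AnalyticAt ℝ (fun x : ℝ ↦ (x : ℂ)) 0 := Complex.ofRealCLM.analyticAt 0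
  have hlin : ∀ {w : ℝ → ℂ}, AnalyticAt ℝ w 0 → ∀ n,
      taylorCoeff (fun x ↦ x * deriv w x + (-1) * w x) n = (n - 1) * taylorCoeff w n := by
    intro w hw n
    rw [taylorCoeff_add (hid.fun_mul hw.deriv) (analyticAt_const.fun_mul hw), taylorCoeff_id_mul_deriv hw,
      taylorCoeff_const_mul _ hw]
    ring
  have hlina : ∀ {w : ℝ → ℂ}, AnalyticAt ℝ w 0 →
      AnalyticAt ℝ (fun x ↦ x * deriv w x + (-1) * w x) 0 := fun hw ↦
    (hid.fun_mul hw.deriv).fun_add (analyticAt_const.fun_mul hw)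
  have hdbl : ∀ {w : ℝ → ℂ} (c d : ℂ), AnalyticAt ℝ w 0 → ∀ n,
      taylorCoeff (fun x ↦ c * w x + d * w (2 * x)) n = (c + d * 2 ^ n) * taylorCoeff w n := by
    intro w c d hw n
    rw [taylorCoeff_add (analyticAt_const.fun_mul hw) (analyticAt_const.fun_mul (hw.comp_mul_left 2)),
      taylorCoeff_const_mul _ hw, taylorCoeff_const_mul _ (hw.comp_mul_left 2),
      taylorCoeff_comp_mul_left]
    push_cast
    ring
  have hdbla : ∀ {w : ℝ → ℂ} (c d : ℂ), AnalyticAt ℝ w 0 →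
      AnalyticAt ℝ (fun x ↦ c * w x + d * w (2 * x)) 0 := fun c d hw ↦
    (analyticAt_const.fun_mul hw).fun_add (analyticAt_const.fun_mul (hw.comp_mul_left 2))
  refine ⟨fun n ↦ ?_, fun n ↦ ?_, fun n ↦ ?_⟩
  · have := taylorCoeff_congr (u := fun x ↦ 3 * u 0 * (x * deriv v x + (-1) * v x) +
      u x * (2 * v x + 1 * v (2 * x))) (v := fun _ ↦ 0)
      (by filter_upwards [h1] with x hx; rw [← hx]; ring) n
    rw [taylorCoeff_fun_zero, taylorCoeff_add (analyticAt_const.fun_mul (hlina hv))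
      (hu.fun_mul (hdbla 2 1 hv)), taylorCoeff_const_mul _ (hlina hv), hlin hv,
      taylorCoeff_mul hu (hdbla 2 1 hv)] at this
    simp only [hdbl 2 1 hv] at this
    simpa only [one_mul, taylorCoeff_zero_right] using this
  · have := taylorCoeff_congr (u := fun x ↦ 3 * v 0 * (x * deriv u x + (-1) * u x) +
      v (3 * x) * (2 * u x + 1 * u (2 * x))) (v := fun _ ↦ 0)
      (by filter_upwards [h2] with x hx; rw [← hx]; ring) n
    rw [taylorCoeff_fun_zero, taylorCoeff_add (analyticAt_const.fun_mul (hlina hu))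
      ((hv.comp_mul_left 3).fun_mul (hdbla 2 1 hu)), taylorCoeff_const_mul _ (hlina hu), hlin hu,
      taylorCoeff_mul (hv.comp_mul_left 3) (hdbla 2 1 hu)] at this
    simp only [hdbl 2 1 hu] at this
    simpa only [taylorCoeff_comp_mul_left, one_mul, taylorCoeff_zero_right,
      Complex.ofReal_ofNat] using this
  · have := taylorCoeff_congr (u := fun x ↦ u 0 * (x * deriv u x + (-1) * u x) + u x * u x)
      (v := fun x ↦ 3 * (v x * (1 * v x + (-1) * v (2 * x))))
      (by filter_upwards [h3] with x hx; linear_combination hx) n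
    rw [taylorCoeff_add (analyticAt_const.fun_mul (hlina hu)) (hu.fun_mul hu),
      taylorCoeff_const_mul _ (hlina hu), hlin hu, taylorCoeff_mul hu hu,
      taylorCoeff_const_mul _ (hv.fun_mul (hdbla 1 (-1) hv)), taylorCoeff_mul hv (hdbla 1 (-1) hv)]
      at this
    simp only [hdbl 1 (-1) hv] at this
    simpa only [neg_one_mul, ← sub_eq_add_neg, taylorCoeff_zero_right] using this

/-! ### Germs at the origin: the doubling relation and simple poles -/

theorem eventually_comp_mul_left_nhdsNE {p : ℝ → Prop} (h : ∀ᶠ x in 𝓝[≠] (0 : ℝ), p x) {c : ℝ}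
    (hc : c ≠ 0) : ∀ᶠ x in 𝓝[≠] (0 : ℝ), p (c * x) := by
  have h1 : Tendsto (fun x : ℝ ↦ c * x) (𝓝[≠] 0) (𝓝[≠] 0) := by
    refine tendsto_nhdsWithin_iff.mpr ⟨?_, ?_⟩
    · have : Tendsto (fun x : ℝ ↦ c * x) (𝓝 0) (𝓝 (c * 0)) :=
        (continuous_const.mul continuous_id).tendsto 0
      rw [mul_zero] at this
      exact this.mono_left nhdsWithin_le_nhds
    · filter_upwards [self_mem_nhdsWithin] with x hx
      exact mul_ne_zero hc hx
  exact h1.eventually h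

theorem AnalyticAt.eventually_eq_of_nhdsNE {u v : ℝ → ℂ} (hu : AnalyticAt ℝ u 0)
    (hv : AnalyticAt ℝ v 0) (h : ∀ᶠ x in 𝓝[≠] 0, u x = v x) : ∀ᶠ x in 𝓝 0, u x = v x :=
  (hu.frequently_eq_iff_eventually_eq hv).mp h.frequently

/-- A meromorphic function with `F (2 x) = F x / 2` is a multiple of `1 / x`. -/
theorem MeromorphicAt.exists_eq_div_of_comp_two_mul {F : ℝ → ℂ} (hF : MeromorphicAt F 0)
    (h : ∀ᶠ x in 𝓝[≠] (0 : ℝ), 2 * F (2 * x) = F x) :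
    ∃ k : ℂ, ∀ᶠ x in 𝓝[≠] (0 : ℝ), F x = k / x := by
  rcases eq_or_ne (meromorphicOrderAt F 0) ⊤ with htop | htop
  · refine ⟨0, ?_⟩
    filter_upwards [meromorphicOrderAt_eq_top_iff.mp htop] with x hx
    simp [hx]
  · obtain ⟨n, hn⟩ := WithTop.ne_top_iff_exists.mp htop
    obtain ⟨g, hg, hg0, hFg⟩ := (meromorphicOrderAt_eq_int_iff hF).mp hn.symm
    have h1 : ∀ᶠ x in 𝓝[≠] (0 : ℝ), (2 : ℂ) * 2 ^ n * g (2 * x) = g x := by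
      filter_upwards [h, hFg, eventually_comp_mul_left_nhdsNE hFg two_ne_zero,
        self_mem_nhdsWithin] with x hx h2 h3 hx0
      have hx0' : ((x : ℂ)) ^ n ≠ 0 := zpow_ne_zero _ (by exact_mod_cast hx0)
      refine mul_left_cancel₀ hx0' ?_
      rw [h2, h3] at hx
      simp only [sub_zero, Complex.real_smul, Complex.ofReal_zpow, Complex.ofReal_mul,
        Complex.ofReal_ofNat, mul_zpow] at hx
      linear_combination hx
    have h2 := AnalyticAt.eventually_eq_of_nhdsNE
      (analyticAt_const.fun_mul (hg.comp_mul_left 2)) hg h1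
    -- Comparing leading coefficients fixes the order `-1`; then `g (2 x) = g x` kills every Taylor
    -- coefficient of positive degree.
    have h3 : (2 : ℂ) * 2 ^ n = 1 := by
      have := h2.self_of_nhds
      simpa [hg0] using this
    have hn1 : n = -1 := by
      have h4 : (2 : ℝ) ^ (n + 1) = 2 ^ (0 : ℤ) := by
        rw [zpow_add_one₀ two_ne_zero, zpow_zero, mul_comm]
        exact Complex.ofReal_injective (by push_cast; exact h3)
      have := zpow_right_injective₀ (by norm_num) (by norm_num) h4
      omega
    have h5 := hg.eventually_eq_const_of_taylorCoeff fun m hm ↦ by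
      have h6 : g =ᶠ[𝓝 0] fun x ↦ g (2 * x) := by
        filter_upwards [h2] with x hx
        rw [← hx, h3, one_mul]
      have h7 := taylorCoeff_congr h6 m
      rw [taylorCoeff_comp_mul_left] at h7
      have h8 : ((2 : ℝ) : ℂ) ^ m ≠ 1 := by
        have : (1 : ℝ) < 2 ^ m := one_lt_pow₀ (by norm_num) hm.ne'
        exact_mod_cast this.ne'
      by_contra hne
      exact h8 (mul_right_cancel₀ hne (by rw [← h7, one_mul]))
    refine ⟨g 0, ?_⟩
    filter_upwards [hFg, h5.filter_mono nhdsWithin_le_nhds] with x h6 h7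
    rw [h6, h7, hn1]
    simp [div_eq_inv_mul]

/-- Write `F t * h t` as `(t F t) (h t / t)`: a simple pole against a simple zero. -/
theorem tendsto_mul_of_hasDerivAt {F h : ℝ → ℂ} {p h' : ℂ}
    (hp : Tendsto (fun t : ℝ ↦ (t : ℂ) * F t) (𝓝[≠] 0) (𝓝 p)) (hh : HasDerivAt h h' 0)
    (h0 : h 0 = 0) : Tendsto (fun t ↦ F t * h t) (𝓝[≠] 0) (𝓝 (p * h')) := by
  have h1 := hasDerivAt_iff_tendsto_slope_zero.mp hh
  refine (hp.mul h1).congr' ?_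
  filter_upwards [self_mem_nhdsWithin] with t ht
  have ht' : (t : ℂ) ≠ 0 := by exact_mod_cast ht
  simp only [zero_add, h0, sub_zero, Complex.real_smul, Complex.ofReal_inv]
  field_simp

/-- If the products of `F t` with increments of `F` stay bounded, then `F` has at most a simple
pole. -/
theorem MeromorphicAt.exists_analyticAt_eq_div {F : ℝ → ℂ} (hF : MeromorphicAt F 0)
    (H : ∀ᶠ x in 𝓝[≠] (0 : ℝ), ∃ (h : ℝ → ℂ) (L : ℂ), h 0 = 0 ∧
      HasDerivAt h (deriv F x) 0 ∧ Tendsto (fun t ↦ F t * h t) (𝓝[≠] 0) (𝓝 L)) :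
    ∃ u : ℝ → ℂ, AnalyticAt ℝ u 0 ∧ ∀ᶠ x in 𝓝[≠] (0 : ℝ), F x = u x / x := by
  rcases eq_or_ne (meromorphicOrderAt F 0) ⊤ with htop | htop
  · refine ⟨fun _ ↦ 0, analyticAt_const, ?_⟩
    filter_upwards [meromorphicOrderAt_eq_top_iff.mp htop] with x hx
    simp [hx]
  obtain ⟨n, hn⟩ := WithTop.ne_top_iff_exists.mp htop
  obtain ⟨g, hg, hg0, hFg⟩ := (meromorphicOrderAt_eq_int_iff hF).mp hn.symm
  rcases le_or_gt (-1) n with hle | hlt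
  · obtain ⟨m, hm⟩ := Int.eq_ofNat_of_zero_le (show 0 ≤ n + 1 by omega)
    refine ⟨fun x ↦ (x : ℂ) ^ m * g x,
      ((Complex.ofRealCLM.analyticAt 0).fun_pow m).fun_mul hg, ?_⟩
    filter_upwards [hFg, self_mem_nhdsWithin] with x hx hx0
    have hx0' : (x : ℂ) ≠ 0 := by exact_mod_cast hx0
    have hz : (x : ℂ) ^ n * x = x ^ m := by
      rw [← zpow_add_one₀ hx0', hm, zpow_natCast]
    rw [hx, eq_div_iff hx0', ← hz]
    simp
    ring
  · exfalso
    -- For a pole of order at least two `1 / (t F t)` tends to `0`, so bounded products force `h t /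
    -- t → 0`, that is `deriv F x = 0` for all small `x`; but the derivative of a pole has finite
    -- order `n - 1`.
    have hinv : Tendsto (fun t : ℝ ↦ ((t : ℂ) * F t)⁻¹) (𝓝[≠] 0) (𝓝 0) := by
      obtain ⟨m, hm⟩ := Int.eq_ofNat_of_zero_le (show 0 ≤ -n - 2 by omega)
      have h1 : Tendsto (fun t : ℝ ↦ (t : ℂ) * ((t : ℂ) ^ m * (g t)⁻¹)) (𝓝 0)
          (𝓝 ((0 : ℝ) * (((0 : ℝ) : ℂ) ^ m * (g 0)⁻¹))) := by
        have hc : Tendsto (fun t : ℝ ↦ (t : ℂ)) (𝓝 0) (𝓝 (0 : ℝ)) :=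
          Complex.continuous_ofReal.tendsto 0
        exact hc.mul ((hc.pow m).mul (hg.continuousAt.tendsto.inv₀ hg0))
      simp only [Complex.ofReal_zero, zero_mul] at h1
      refine (h1.mono_left nhdsWithin_le_nhds).congr' ?_
      filter_upwards [hFg, self_mem_nhdsWithin] with t ht ht0
      have ht0' : (t : ℂ) ≠ 0 := by exact_mod_cast ht0
      have hz : (t : ℂ) * t ^ n = ((t : ℂ) * t ^ m)⁻¹ := by
        rw [eq_comm, inv_eq_iff_eq_inv, ← zpow_one_add₀ ht0', ← zpow_neg, ← pow_succ',
          ← zpow_natCast]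
        congr 1
        omega
      rw [ht]
      simp only [sub_zero, Complex.real_smul, Complex.ofReal_zpow]
      rw [← mul_assoc (t : ℂ) ((t : ℂ) ^ n) (g t), hz, mul_inv, inv_inv]
      ring
    have hder : ∀ᶠ x in 𝓝[≠] (0 : ℝ), deriv F x = 0 := by
      filter_upwards [H] with x hx
      obtain ⟨h, L, h0, hh, hL⟩ := hx
      have h1 := hasDerivAt_iff_tendsto_slope_zero.mp hh
      have h2 := hinv.mul hL
      rw [zero_mul] at h2
      refine tendsto_nhds_unique h1 (h2.congr' ?_)
      have hne : ∀ᶠ t in 𝓝[≠] (0 : ℝ), F t ≠ 0 :=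
        (meromorphicOrderAt_ne_top_iff_eventually_ne_zero hF).mp htop
      filter_upwards [hne, self_mem_nhdsWithin] with t ht ht0
      have ht0' : (t : ℂ) ≠ 0 := by exact_mod_cast ht0
      simp only [zero_add, h0, sub_zero, Complex.real_smul, Complex.ofReal_inv]
      field_simp
    have h1 := meromorphicOrderAt_deriv_eq_sub_one
      (show ((n : ℤ) : ℝ) ≠ 0 by exact_mod_cast (by omega : n ≠ 0)) hn.symm
    rw [meromorphicOrderAt_eq_top_iff.mpr hder] at h1
    exact WithTop.coe_ne_top h1.symm

theorem ContinuousAt.tendsto_comp_add_mul {F : ℝ → ℂ} {y : ℝ} (hF : ContinuousAt F y) (c : ℝ) :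
    Tendsto (fun t ↦ F (y + c * t)) (𝓝[≠] 0) (𝓝 (F y)) := by
  have h1 : Tendsto (fun t : ℝ ↦ y + c * t) (𝓝 0) (𝓝 (y + c * 0)) :=
    (continuous_const.add (continuous_const.mul continuous_id)).tendsto 0
  rw [mul_zero, add_zero] at h1
  exact (hF.tendsto.comp h1).mono_left nhdsWithin_le_nhds

theorem hasDerivAt_comp_add_mul {F : ℝ → ℂ} {y : ℝ} (hF : DifferentiableAt ℝ F y) (c : ℝ) :
    HasDerivAt (fun t ↦ F (y + c * t)) (c * deriv F y) 0 := by
  have h1 : HasDerivAt (fun t : ℝ ↦ y + c * t) c 0 := by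
    simpa using ((hasDerivAt_id (0 : ℝ)).const_mul c).const_add y
  have h2 : HasDerivAt F (deriv F y) (y + c * 0) := by simpa using hF.hasDerivAt
  simpa [Function.comp_def] using h2.scomp (0 : ℝ) h1

/-! ### The functional equations of G₂ -/

/-- The left-hand side of the functional equation of `G₂` for the rotation by `π / 3`; the short
roots take the values `X`, `Y`, `Y - X`, the long ones `X + Y`, `2 Y - X`, `Y - 2 X`. -/
def g2Mixed (F G : ℝ → ℂ) (X Y : ℝ) : ℂ :=
  G (X + Y) * (F X + F Y) + G (2 * Y - X) * (F Y + F (Y - X)) + G (Y - 2 * X) * (F (Y - X) - F X)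

/-- The left-hand side of the functional equation of `G₂` for the rotation by `2 π / 3`. -/
def g2Square (F G : ℝ → ℂ) (X Y : ℝ) : ℂ :=
  F X * F Y + F Y * F (Y - X) - F (Y - X) * F X +
    3 * (G (X + Y) * G (2 * Y - X) + G (2 * Y - X) * G (Y - 2 * X) - G (Y - 2 * X) * G (X + Y))

/-- No root of `G₂` vanishes at the point with coordinates `X`, `Y`. -/
def G2Regular (X Y : ℝ) : Prop :=
  X ≠ 0 ∧ Y ≠ 0 ∧ Y - X ≠ 0 ∧ X + Y ≠ 0 ∧ 2 * Y - X ≠ 0 ∧ Y - 2 * X ≠ 0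

/-- Both functional equations of `G₂` hold near the origin. -/
def SolvesG2 (F G : ℝ → ℂ) : Prop :=
  ∃ ε > 0, ∀ X Y : ℝ, |X| < ε → |Y| < ε → G2Regular X Y → g2Mixed F G X Y = 0 ∧ g2Square F G X Y = 0

namespace SolvesG2

variable {F G : ℝ → ℂ}

/-- Used to let the short root `X = t` tend to `0` with `Y = x` fixed; for `|t| < |x| / 2` no other
root vanishes. -/
theorem eventually_short (h : SolvesG2 F G) : ∀ᶠ x in 𝓝[≠] (0 : ℝ), ∀ᶠ t in 𝓝[≠] (0 : ℝ),
    g2Mixed F G t x = 0 ∧ g2Square F G t x = 0 := by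
  obtain ⟨ε, hε, H⟩ := h
  have hb : ∀ᶠ x in 𝓝[≠] (0 : ℝ), |x| < ε :=
    (continuous_abs.tendsto' (0 : ℝ) 0 abs_zero).eventually_lt_const hε |>.filter_mono
      nhdsWithin_le_nhds
  filter_upwards [hb, self_mem_nhdsWithin] with x hx hx0
  have hx0 : x ≠ 0 := hx0
  have hs : ∀ᶠ t in 𝓝[≠] (0 : ℝ), |t| < |x| / 2 :=
    (continuous_abs.tendsto' (0 : ℝ) 0 abs_zero).eventually_lt_const (by positivity)
      |>.filter_mono nhdsWithin_le_nhds
  filter_upwards [hb, hs, self_mem_nhdsWithin] with t ht ht' ht0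
  refine H t x ht hx ⟨ht0, hx0, ?_, ?_, ?_, ?_⟩ <;> intro hc <;>
    rcases abs_cases x with ⟨h1, _⟩ | ⟨h1, _⟩ <;> rcases abs_cases t with ⟨h2, _⟩ | ⟨h2, _⟩ <;>
    rw [h1, h2] at ht' <;> linarith

/-- Used to let the long root `Y - 2 X = t` tend to `0` with `X = x` fixed. -/
theorem eventually_long (h : SolvesG2 F G) : ∀ᶠ x in 𝓝[≠] (0 : ℝ), ∀ᶠ t in 𝓝[≠] (0 : ℝ),
    g2Mixed F G x (2 * x + t) = 0 ∧ g2Square F G x (2 * x + t) = 0 := by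
  obtain ⟨ε, hε, H⟩ := h
  have hb : ∀ᶠ x in 𝓝[≠] (0 : ℝ), |x| < ε / 3 :=
    (continuous_abs.tendsto' (0 : ℝ) 0 abs_zero).eventually_lt_const (by positivity)
      |>.filter_mono nhdsWithin_le_nhds
  filter_upwards [hb, self_mem_nhdsWithin] with x hx hx0
  have hx0 : x ≠ 0 := hx0
  have hs : ∀ᶠ t in 𝓝[≠] (0 : ℝ), |t| < |x| / 2 :=
    (continuous_abs.tendsto' (0 : ℝ) 0 abs_zero).eventually_lt_const (by positivity)
      |>.filter_mono nhdsWithin_le_nhds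
  filter_upwards [hs, self_mem_nhdsWithin] with t ht' ht0
  have ht0 : t ≠ 0 := ht0
  have hlt : |2 * x + t| < ε := by
    have := abs_add_le (2 * x) t
    rw [abs_mul, abs_two] at this
    linarith
  refine H x (2 * x + t) (by linarith) hlt ⟨hx0, ?_, ?_, ?_, ?_, ?_⟩ <;> intro hc
  case refine_5 => exact ht0 (by linarith)
  all_goals
    rcases abs_cases x with ⟨h1, _⟩ | ⟨h1, _⟩ <;> rcases abs_cases t with ⟨h2, _⟩ | ⟨h2, _⟩ <;>
    rw [h1, h2] at ht' <;> linarith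

/-- Solve each equation for the terms containing `F t`, the only factor singular at `t = 0`; the
rest is continuous there. -/
theorem eventually_tendsto_short (h : SolvesG2 F G) (hF : MeromorphicAt F 0)
    (hG : MeromorphicAt G 0) : ∀ᶠ x in 𝓝[≠] (0 : ℝ),
    Tendsto (fun t ↦ F t * (F x - F (x + (-1) * t))) (𝓝[≠] 0)
      (𝓝 (-(F x * F x + 3 * (2 * (G x * G (2 * x)) - G x * G x)))) ∧
    Tendsto (fun t ↦ F t * (G (x + 1 * t) - G (x + (-2) * t))) (𝓝[≠] 0)
      (𝓝 (-(2 * (G x * F x) + 2 * (G (2 * x) * F x)))) := by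
  filter_upwards [h.eventually_short, hF.eventually_analyticAt, hG.eventually_analyticAt,
    eventually_comp_mul_left_nhdsNE hG.eventually_analyticAt two_ne_zero] with x hx hFx hGx hG2x
  have f1 := hFx.continuousAt.tendsto_comp_add_mul (-1)
  have g1 := hGx.continuousAt.tendsto_comp_add_mul 1
  have g2 := hGx.continuousAt.tendsto_comp_add_mul (-2)
  have g3 := hG2x.continuousAt.tendsto_comp_add_mul (-1)
  have key (t : ℝ) : t + x = x + 1 * t ∧ x - t = x + (-1) * t ∧ 2 * x - t = 2 * x + (-1) * t ∧
      x - 2 * t = x + (-2) * t := ⟨by ring, by ring, by ring, by ring⟩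
  constructor
  · have := ((f1.const_mul (F x)).add
      ((((g1.mul g3).add (g3.mul g2)).sub (g2.mul g1)).const_mul 3)).neg
    refine (this.congr' ?_).trans_eq ?_
    · filter_upwards [hx] with t ht
      have ht := ht.2
      obtain ⟨k1, k2, k3, k4⟩ := key t
      rw [g2Square, k1, k2, k3, k4] at ht
      linear_combination -ht
    · congr 1
      ring
  · have := ((g1.mul_const (F x)).add
      ((g3.mul (f1.const_add (F x))).add (g2.mul f1))).neg
    refine (this.congr' ?_).trans_eq ?_
    · filter_upwards [hx] with t ht
      have ht := ht.1
      obtain ⟨k1, k2, k3, k4⟩ := key t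
      rw [g2Mixed, k1, k2, k3, k4] at ht
      linear_combination -ht
    · congr 1
      ring

/-- The same with `G t` as singular factor. In the square equation only the existence of the limit
matters: it serves to bound the pole of `G`. -/
theorem eventually_tendsto_long (h : SolvesG2 F G) (hF : MeromorphicAt F 0)
    (hG : MeromorphicAt G 0) : ∀ᶠ x in 𝓝[≠] (0 : ℝ),
    (∃ L, Tendsto (fun t ↦ G t * (G (3 * x + 2 * t) - G (3 * x + 1 * t))) (𝓝[≠] 0) (𝓝 L)) ∧
    Tendsto (fun t ↦ G t * (F (x + 1 * t) - F x)) (𝓝[≠] 0)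
      (𝓝 (-(2 * (G (3 * x) * (F x + F (2 * x)))))) := by
  filter_upwards [h.eventually_long, hF.eventually_analyticAt,
    eventually_comp_mul_left_nhdsNE hF.eventually_analyticAt two_ne_zero,
    eventually_comp_mul_left_nhdsNE hG.eventually_analyticAt three_ne_zero] with x hx hFx hF2x hGx
  have f1 := hFx.continuousAt.tendsto_comp_add_mul 1
  have f2 := hF2x.continuousAt.tendsto_comp_add_mul 1
  have g1 := hGx.continuousAt.tendsto_comp_add_mul 1
  have g2 := hGx.continuousAt.tendsto_comp_add_mul 2
  have key (t : ℝ) : x + (2 * x + t) = 3 * x + 1 * t ∧ 2 * (2 * x + t) - x = 3 * x + 2 * t ∧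
      2 * x + t - x = x + 1 * t ∧ 2 * x + t - 2 * x = t ∧ 2 * x + t = 2 * x + 1 * t :=
    ⟨by ring, by ring, by ring, by ring, by ring⟩
  constructor
  · refine ⟨_, (((((f2.const_mul (F x)).add (f2.mul f1)).sub (f1.mul_const (F x))).const_mul
      (1 / 3)).add (g1.mul g2)).neg.congr' ?_⟩
    filter_upwards [hx] with t ht
    have ht := ht.2
    obtain ⟨k1, k2, k3, k4, k5⟩ := key t
    rw [g2Square, k1, k2, k3, k4, k5] at ht
    linear_combination (-1 / 3) * ht
  · have := ((g1.mul (f2.const_add (F x))).add (g2.mul (f2.add f1))).neg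
    refine (this.congr' ?_).trans_eq ?_
    · filter_upwards [hx] with t ht
      have ht := ht.1
      obtain ⟨k1, k2, k3, k4, k5⟩ := key t
      rw [g2Mixed, k1, k2, k3, k4, k5] at ht
      linear_combination -ht
    · congr 1
      ring

theorem exists_analyticAt_eq_div_short (h : SolvesG2 F G) (hF : MeromorphicAt F 0)
    (hG : MeromorphicAt G 0) :
    ∃ u : ℝ → ℂ, AnalyticAt ℝ u 0 ∧ ∀ᶠ x in 𝓝[≠] (0 : ℝ), F x = u x / x := by
  refine hF.exists_analyticAt_eq_div ?_
  filter_upwards [h.eventually_tendsto_short hF hG, hF.eventually_analyticAt] with x hx hFx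
  refine ⟨_, _, by simp, ?_, hx.1⟩
  simpa using (hasDerivAt_comp_add_mul hFx.differentiableAt (-1)).const_sub (F x)

theorem exists_analyticAt_eq_div_long (h : SolvesG2 F G) (hF : MeromorphicAt F 0)
    (hG : MeromorphicAt G 0) :
    ∃ v : ℝ → ℂ, AnalyticAt ℝ v 0 ∧ ∀ᶠ x in 𝓝[≠] (0 : ℝ), G x = v x / x := by
  refine hG.exists_analyticAt_eq_div ?_
  have h3 : (1 / 3 : ℝ) ≠ 0 := by norm_num
  -- The increments of `G` are taken around `3 x`, hence the rescaling by `1/3`.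
  filter_upwards [eventually_comp_mul_left_nhdsNE (h.eventually_tendsto_long hF hG) h3,
    hG.eventually_analyticAt] with x hx hGx
  obtain ⟨L, hL⟩ := hx.1
  rw [show 3 * (1 / 3 * x) = x by ring] at hL
  refine ⟨_, L, by simp, ?_, hL⟩
  have := (hasDerivAt_comp_add_mul hGx.differentiableAt 2).sub
    (hasDerivAt_comp_add_mul hGx.differentiableAt 1)
  have h1 : ((2 : ℝ) : ℂ) * deriv G x - ((1 : ℝ) : ℂ) * deriv G x = deriv G x := by
    push_cast
    ring
  rw [h1] at this
  exact this

end SolvesG2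

theorem tendsto_mul_of_eq_div {F u : ℝ → ℂ} (hu : AnalyticAt ℝ u 0)
    (h : ∀ᶠ x in 𝓝[≠] (0 : ℝ), F x = u x / x) :
    Tendsto (fun t : ℝ ↦ (t : ℂ) * F t) (𝓝[≠] 0) (𝓝 (u 0)) := by
  refine (hu.continuousAt.tendsto.mono_left nhdsWithin_le_nhds).congr' ?_
  filter_upwards [h, self_mem_nhdsWithin] with x hx hx0
  have hx0' : (x : ℂ) ≠ 0 := by exact_mod_cast hx0
  rw [hx]
  field_simp

theorem eventually_deriv_of_eq_div {F u : ℝ → ℂ} (hu : AnalyticAt ℝ u 0)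
    (h : ∀ᶠ x in 𝓝[≠] (0 : ℝ), F x = u x / x) :
    ∀ᶠ x in 𝓝[≠] (0 : ℝ), deriv F x = (x * deriv u x - u x) / x ^ 2 := by
  have h1 : F =ᶠ[𝓝[≠] 0] fun x ↦ u x / x := h
  filter_upwards [h1.nhdsNE_deriv,
    hu.eventually_analyticAt.filter_mono nhdsWithin_le_nhds, self_mem_nhdsWithin] with x hx hux hx0
  have hx0' : (x : ℂ) ≠ 0 := by exact_mod_cast hx0
  have h2 : HasDerivAt (fun y : ℝ ↦ (y : ℂ)) 1 x := Complex.ofRealCLM.hasDerivAt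
  rw [hx, (hux.differentiableAt.hasDerivAt.fun_div h2 hx0').deriv]
  ring

/-- Two nonzero meromorphic functions which solve the functional equations of `G₂` are multiples of
`1 / x`. -/
theorem SolvesG2.exists_eq_div {F G : ℝ → ℂ} (h : SolvesG2 F G) (hF : MeromorphicAt F 0)
    (hG : MeromorphicAt G 0) (hF0 : ¬ ∀ᶠ x in 𝓝[≠] (0 : ℝ), F x = 0)
    (hG0 : ¬ ∀ᶠ x in 𝓝[≠] (0 : ℝ), G x = 0) :
    (∃ p : ℂ, ∀ᶠ x in 𝓝[≠] (0 : ℝ), F x = p / x) ∧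
      ∃ q : ℂ, ∀ᶠ x in 𝓝[≠] (0 : ℝ), G x = q / x := by
  obtain ⟨u, hu, hFu⟩ := h.exists_analyticAt_eq_div_short hF hG
  obtain ⟨v, hv, hGv⟩ := h.exists_analyticAt_eq_div_long hF hG
  have hp := tendsto_mul_of_eq_div hu hFu
  have hq := tendsto_mul_of_eq_div hv hGv
  have hFu2 := eventually_comp_mul_left_nhdsNE hFu two_ne_zero
  have hGv2 := eventually_comp_mul_left_nhdsNE hGv two_ne_zero
  have hGv3 := eventually_comp_mul_left_nhdsNE hGv three_ne_zero
  have hdu := eventually_deriv_of_eq_div hu hFu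
  have hdv := eventually_deriv_of_eq_div hv hGv
  have hid : AnalyticAt ℝ (fun x : ℝ ↦ (x : ℂ)) 0 := Complex.ofRealCLM.analyticAt 0
  have hu2 := hu.comp_mul_left 2
  have hv2 := hv.comp_mul_left 2
  have hv3 := hv.comp_mul_left 3
  have hu' := hu.deriv
  have hv' := hv.deriv
  have hs := h.eventually_tendsto_short hF hG
  have hl := h.eventually_tendsto_long hF hG
  -- Each of the three equations equates two values of one limit: residue times derivative, and the
  -- value given by the functional equation. Clearing the powers of `x` makes both sides analytic,
  -- so the identity extends to `0`.
  have e1 : ∀ᶠ x in 𝓝 (0 : ℝ),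
      3 * u 0 * (x * deriv v x - v x) + u x * (2 * v x + v (2 * x)) = 0 := by
    refine AnalyticAt.eventually_eq_of_nhdsNE
      ((analyticAt_const.fun_mul ((hid.fun_mul hv').fun_sub hv)).fun_add
        (hu.fun_mul ((analyticAt_const.fun_mul hv).fun_add hv2))) analyticAt_const ?_
    filter_upwards [hs, hG.eventually_analyticAt, hdv, hFu, hGv, hGv2, self_mem_nhdsWithin]
      with x hx hGx hd k1 k2 k3 hx0
    have hx0' : (x : ℂ) ≠ 0 := by exact_mod_cast hx0
    have hD := (hasDerivAt_comp_add_mul hGx.differentiableAt 1).sub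
      (hasDerivAt_comp_add_mul hGx.differentiableAt (-2))
    have := tendsto_nhds_unique (tendsto_mul_of_hasDerivAt hp hD (by simp)) hx.2
    rw [hd, k1, k2, k3] at this
    push_cast at this
    generalize v (2 * x) = w at this ⊢
    field_simp at this
    linear_combination this
  have e2 : ∀ᶠ x in 𝓝 (0 : ℝ),
      3 * v 0 * (x * deriv u x - u x) + v (3 * x) * (2 * u x + u (2 * x)) = 0 := by
    refine AnalyticAt.eventually_eq_of_nhdsNE
      ((analyticAt_const.fun_mul ((hid.fun_mul hu').fun_sub hu)).fun_add
        (hv3.fun_mul ((analyticAt_const.fun_mul hu).fun_add hu2))) analyticAt_const ?_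
    filter_upwards [hl, hF.eventually_analyticAt, hdu, hFu, hFu2, hGv3, self_mem_nhdsWithin]
      with x hx hFx hd k1 k2 k3 hx0
    have hx0' : (x : ℂ) ≠ 0 := by exact_mod_cast hx0
    have hD := (hasDerivAt_comp_add_mul hFx.differentiableAt 1).sub_const (F x)
    have := tendsto_nhds_unique (tendsto_mul_of_hasDerivAt hq hD (by simp)) hx.2
    rw [hd, k1, k2, k3] at this
    push_cast at this
    generalize u (2 * x) = w, v (3 * x) = w' at this ⊢
    field_simp at this
    linear_combination this
  have e3 : ∀ᶠ x in 𝓝 (0 : ℝ), u 0 * (x * deriv u x - u x) + u x * u x =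
      3 * (v x * (v x - v (2 * x))) := by
    refine AnalyticAt.eventually_eq_of_nhdsNE
      ((analyticAt_const.fun_mul ((hid.fun_mul hu').fun_sub hu)).fun_add (hu.fun_mul hu))
      (analyticAt_const.fun_mul (hv.fun_mul (hv.fun_sub hv2))) ?_
    filter_upwards [hs, hF.eventually_analyticAt, hdu, hFu, hGv, hGv2, self_mem_nhdsWithin]
      with x hx hFx hd k1 k2 k3 hx0
    have hx0' : (x : ℂ) ≠ 0 := by exact_mod_cast hx0
    have hD := (hasDerivAt_comp_add_mul hFx.differentiableAt (-1)).const_sub (F x)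
    have := tendsto_nhds_unique (tendsto_mul_of_hasDerivAt hp hD (by simp)) hx.1
    rw [hd, k1, k2, k3] at this
    push_cast at this
    generalize v (2 * x) = w at this ⊢
    field_simp at this
    linear_combination this
  have hrec := g2Recursion_taylorCoeff hu hv e1 e2 e3
  have hu0 := hu.exists_taylorCoeff_ne_zero fun hc ↦ hF0 <| by
    filter_upwards [hFu, hc.filter_mono nhdsWithin_le_nhds] with x h1 h2
    rw [h1, h2, zero_div]
  have hv0 := hv.exists_taylorCoeff_ne_zero fun hc ↦ hG0 <| by
    filter_upwards [hGv, hc.filter_mono nhdsWithin_le_nhds] with x h1 h2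
    rw [h1, h2, zero_div]
  refine ⟨⟨u 0, ?_⟩, ⟨v 0, ?_⟩⟩
  · filter_upwards [hFu, (hu.eventually_eq_const_of_taylorCoeff fun n hn ↦
      (hrec.eq_zero hu0 hv0 n hn).1).filter_mono nhdsWithin_le_nhds] with x h1 h2
    rw [h1, h2]
  · filter_upwards [hGv, (hv.eventually_eq_const_of_taylorCoeff fun n hn ↦
      (hrec.eq_zero hu0 hv0 n hn).2).filter_mono nhdsWithin_le_nhds] with x h1 h2
    rw [h1, h2]

/-! ### Products of two reflections and their planes -/

noncomputable section

namespace GeneralizedDunkl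

variable {ι V N : Type*} [NormedAddCommGroup V] [InnerProductSpace ℝ V]
  [AddCommGroup N] [Module ℝ N] {P : RootPairing ι ℝ V N}

/-- Orthogonality of the reflections forces the coroots to be the usual `2 (α, ·) / (α, α)`; expand
`(s x, s α) = (x, α)`. -/
theorem IsOrthogonal.coroot'_mul_inner_self (hP : IsOrthogonal P) (i : ι) (x : V) :
    P.coroot' i x * inner ℝ (P.root i) (P.root i) = 2 * inner ℝ (P.root i) x := by
  have h := hP i x (P.root i)
  rw [P.reflection_apply_self, P.reflection_apply, inner_neg_right, inner_sub_left,
    real_inner_smul_left] at h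
  have := real_inner_comm x (P.root i)
  linarith

theorem inner_root_self_pos (P : RootPairing ι ℝ V N) (i : ι) :
    0 < inner ℝ (P.root i) (P.root i) :=
  real_inner_self_pos.mpr (P.ne_zero i)

theorem IsOrthogonal.coroot'_eq_zero_iff (hP : IsOrthogonal P) (i : ι) (x : V) :
    P.coroot' i x = 0 ↔ inner ℝ (P.root i) x = 0 := by
  have h := hP.coroot'_mul_inner_self i x
  have h0 := (inner_root_self_pos P i).ne'
  constructor <;> intro h1
  · rw [h1, zero_mul] at h
    linarith
  · rw [h1, mul_zero] at h
    exact (mul_eq_zero.mp h).resolve_right h0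

theorem IsOrthogonal.pairing_mul_inner_self (hP : IsOrthogonal P) (i j : ι) :
    P.pairing i j * inner ℝ (P.root j) (P.root j) = 2 * inner ℝ (P.root i) (P.root j) := by
  rw [← P.root_coroot'_eq_pairing, hP.coroot'_mul_inner_self, real_inner_comm]

theorem IsOrthogonal.reflection_apply_of_inner_eq_zero (hP : IsOrthogonal P) {i : ι} {x : V}
    (h : inner ℝ (P.root i) x = 0) : P.reflection i x = x := by
  rw [P.reflection_apply, (hP.coroot'_eq_zero_iff i x).mpr h, zero_smul, sub_zero]

theorem reflection_eq_of_root_eq_neg {i j : ι} (h : P.root i = -P.root j) :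
    P.reflection i = P.reflection j := by
  rw [P.root_eq_neg_iff.mp h, P.reflection_reflectionPerm, mul_assoc, ← pow_two, P.reflection_sq,
    mul_one]

theorem reflection_eq_iff [P.IsReduced] {i j : ι} :
    P.reflection i = P.reflection j ↔ P.root i = P.root j ∨ P.root i = -P.root j := by
  constructor
  · intro h
    refine RootPairing.IsReduced.eq_or_eq_neg i j fun hli ↦ ?_
    have h1 : P.reflection i (P.root i) = P.reflection j (P.root i) := by rw [h]
    rw [P.reflection_apply_self, P.reflection_apply] at h1
    have h2 := LinearIndependent.pair_iff.mp hli 2 (-(P.coroot' j (P.root i))) (by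
      rw [two_smul, neg_smul, ← sub_eq_add_neg, add_sub_assoc, ← h1, add_neg_cancel])
    norm_num at h2
  · rintro (h | h)
    · rw [P.root.injective h]
    · exact reflection_eq_of_root_eq_neg h

/-- A fixed point satisfies `s_i x = s_j x`, so a multiple of one root equals a multiple of the
other. This identifies the plane of the rotation with the span of the two roots. -/
theorem IsOrthogonal.reflection_mul_reflection_apply_eq_iff (hP : IsOrthogonal P) {i j : ι}
    (h : LinearIndependent ℝ ![P.root i, P.root j]) (x : V) :
    (P.reflection i * P.reflection j) x = x ↔
      inner ℝ (P.root i) x = 0 ∧ inner ℝ (P.root j) x = 0 := by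
  constructor
  · intro hx
    have h1 : P.reflection j x = P.reflection i x := by
      have := congrArg (P.reflection i) hx
      rw [LinearEquiv.mul_apply, ← LinearEquiv.mul_apply, ← pow_two, P.reflection_sq] at this
      exact this
    rw [P.reflection_apply, P.reflection_apply] at h1
    have h2 := LinearIndependent.pair_iff.mp h (P.coroot' i x) (-P.coroot' j x) (by
      rw [neg_smul, ← sub_eq_add_neg, sub_eq_zero]
      exact (sub_right_injective h1).symm)
    rw [neg_eq_zero] at h2
    exact ⟨(hP.coroot'_eq_zero_iff i x).mp h2.1, (hP.coroot'_eq_zero_iff j x).mp h2.2⟩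
  · rintro ⟨h1, h2⟩
    rw [LinearEquiv.mul_apply, hP.reflection_apply_of_inner_eq_zero h2,
      hP.reflection_apply_of_inner_eq_zero h1]

theorem mem_span_pair_orthogonal {a b x : V} :
    x ∈ (Submodule.span ℝ {a, b})ᗮ ↔ inner ℝ a x = 0 ∧ inner ℝ b x = 0 := by
  rw [Submodule.mem_orthogonal]
  constructor
  · intro h
    exact ⟨h a (Submodule.subset_span (by simp)), h b (Submodule.subset_span (by simp))⟩
  · rintro ⟨h1, h2⟩ u hu
    obtain ⟨c, d, rfl⟩ := Submodule.mem_span_pair.mp hu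
    rw [inner_add_left, inner_smul_left, inner_smul_left, h1, h2, mul_zero, mul_zero, add_zero]

theorem span_pair_orthogonal_orthogonal (a b : V) :
    (Submodule.span ℝ {a, b})ᗮᗮ = Submodule.span ℝ {a, b} := by
  have : FiniteDimensional ℝ (Submodule.span ℝ {a, b}) :=
    FiniteDimensional.span_of_finite ℝ (Set.toFinite _)
  exact Submodule.orthogonal_orthogonal _

theorem IsOrthogonal.isRotationPlaneBasis (hP : IsOrthogonal P) {i j : ι}
    (h : LinearIndependent ℝ ![P.root i, P.root j]) {e₁ e₂ : V} (ho : Orthonormal ℝ ![e₁, e₂])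
    (hs : Submodule.span ℝ {e₁, e₂} = Submodule.span ℝ {P.root i, P.root j}) :
    IsRotationPlaneBasis (P.reflection i * P.reflection j) e₁ e₂ := by
  refine ⟨ho, ?_⟩
  have hk : LinearMap.ker (((P.reflection i * P.reflection j : V ≃ₗ[ℝ] V) : V →ₗ[ℝ] V) -
      LinearMap.id) = (Submodule.span ℝ {P.root i, P.root j})ᗮ := by
    ext x
    rw [mem_span_pair_orthogonal, ← hP.reflection_mul_reflection_apply_eq_iff h, LinearMap.mem_ker,
      LinearMap.sub_apply, sub_eq_zero]
    rfl
  rw [hk, hs, span_pair_orthogonal_orthogonal]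

/-- If a product of two reflections equals the product of the reflections in two independent roots,
then the roots of the former lie in the plane of the latter. -/
theorem IsOrthogonal.root_mem_span_of_mul_eq [P.IsReduced] (hP : IsOrthogonal P) {i j k l : ι}
    (h : LinearIndependent ℝ ![P.root i, P.root j])
    (hr : P.reflection k * P.reflection l = P.reflection i * P.reflection j) :
    P.root l ∈ Submodule.span ℝ {P.root i, P.root j} := by
  have hkl : LinearIndependent ℝ ![P.root k, P.root l] := by
    by_contra hc
    have h1 := reflection_eq_iff.mpr (RootPairing.IsReduced.eq_or_eq_neg k l hc)
    rw [h1, ← pow_two, P.reflection_sq] at hr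
    have h2 := (hP.reflection_mul_reflection_apply_eq_iff h (P.root i)).mp (by rw [← hr]; rfl)
    exact (inner_root_self_pos P i).ne' h2.1
  rw [← span_pair_orthogonal_orthogonal, Submodule.mem_orthogonal]
  intro x hx
  rw [mem_span_pair_orthogonal, ← hP.reflection_mul_reflection_apply_eq_iff h, ← hr,
    hP.reflection_mul_reflection_apply_eq_iff hkl] at hx
  rw [real_inner_comm]
  exact hx.2

/-- An orthonormal basis of the plane spanned by two independent vectors. -/
theorem exists_orthonormal_span_pair {a b : V} (h : LinearIndependent ℝ ![a, b]) :
    ∃ e₁ e₂ : V, Orthonormal ℝ ![e₁, e₂] ∧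
      Submodule.span ℝ {e₁, e₂} = Submodule.span ℝ {a, b} ∧ orientedArea e₁ e₂ a b ≠ 0 := by
  have ha : a ≠ 0 := h.ne_zero 0
  have ha' : inner ℝ a a ≠ 0 := (real_inner_self_pos.mpr ha).ne'
  have hna : ‖a‖ ≠ 0 := norm_ne_zero_iff.mpr ha
  set c : V := b - (inner ℝ a b / inner ℝ a a) • a with hc
  have hc0 : c ≠ 0 := by
    intro h0
    have := LinearIndependent.pair_iff.mp h (-(inner ℝ a b / inner ℝ a a)) 1 (by
      rw [one_smul, neg_smul, neg_add_eq_sub, ← hc, h0])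
    exact one_ne_zero this.2
  have hnc : ‖c‖ ≠ 0 := norm_ne_zero_iff.mpr hc0
  have hac : inner ℝ a c = 0 := by
    rw [hc, inner_sub_right, inner_smul_right, div_mul_cancel₀ _ ha', sub_self]
  have hbc : inner ℝ b c = ‖c‖ ^ 2 := by
    have : b = c + (inner ℝ a b / inner ℝ a a) • a := by rw [hc]; abel
    rw [this, inner_add_left, inner_smul_left, hac, mul_zero, add_zero, real_inner_self_eq_norm_sq]
  refine ⟨‖a‖⁻¹ • a, ‖c‖⁻¹ • c, ?_, ?_, ?_⟩
  · rw [orthonormal_iff_ite]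
    intro i j
    fin_cases i <;> fin_cases j <;>
      simp [inner_smul_left, inner_smul_right, hac, real_inner_comm a c, norm_smul, hna, hnc]
  · rw [Submodule.span_insert, Submodule.span_insert,
      Submodule.span_singleton_smul_eq (IsUnit.mk0 _ (inv_ne_zero hna)),
      Submodule.span_singleton_smul_eq (IsUnit.mk0 _ (inv_ne_zero hnc)),
      ← Submodule.span_insert, ← Submodule.span_insert]
    apply le_antisymm <;> rw [Submodule.span_le, Set.insert_subset_iff, Set.singleton_subset_iff]
    · exact ⟨Submodule.subset_span (by simp),
        Submodule.mem_span_pair.mpr ⟨-(inner ℝ a b / inner ℝ a a), 1, by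
          rw [one_smul, neg_smul, neg_add_eq_sub]⟩⟩
    · exact ⟨Submodule.subset_span (by simp),
        Submodule.mem_span_pair.mpr ⟨inner ℝ a b / inner ℝ a a, 1, by
          rw [one_smul, hc, add_sub_cancel]⟩⟩
  · have h1 : inner ℝ a a = ‖a‖ ^ 2 := real_inner_self_eq_norm_sq a
    rw [orientedArea]
    simp only [inner_smul_right, hac, hbc, h1, mul_zero, zero_mul, sub_zero]
    positivity

theorem orientedArea_smul_add_smul (e₁ e₂ a b : V) (c d c' d' : ℝ) :
    orientedArea e₁ e₂ (c • a + d • b) (c' • a + d' • b) =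
      (c * d' - d * c') * orientedArea e₁ e₂ a b := by
  simp only [orientedArea, inner_add_left, real_inner_smul_left]
  ring

theorem orientedArea_neg_left (e₁ e₂ a b : V) :
    orientedArea e₁ e₂ (-a) b = -orientedArea e₁ e₂ a b := by
  simp only [orientedArea, inner_neg_left]
  ring

theorem orientedArea_neg_right (e₁ e₂ a b : V) :
    orientedArea e₁ e₂ a (-b) = -orientedArea e₁ e₂ a b := by
  simp only [orientedArea, inner_neg_left]
  ring

end GeneralizedDunkl

end

/-! ### Rotation sequences: the roots of a plane and the pairs giving one rotation -/

noncomputable section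

namespace GeneralizedDunkl

variable {ι V N : Type*} [NormedAddCommGroup V] [InnerProductSpace ℝ V]
  [AddCommGroup N] [Module ℝ N] {P : RootPairing ι ℝ V N}

/-- The index of `- s_j (α_i)`. -/
def rotationStep (P : RootPairing ι ℝ V N) (i j : ι) : ι :=
  P.reflectionPerm j (P.reflectionPerm i i)

/-- The sequence of roots starting with `α_i`, `α_j` in which each root is the negative of the
mirror image of its second predecessor in the hyperplane orthogonal to its predecessor. -/
def rotationSeq (P : RootPairing ι ℝ V N) : ι → ι → ℕ → ι
  | i, _, 0 => i
  | i, j, k + 1 => rotationSeq P j (rotationStep P i j) k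

/-- The coordinates of the roots of `rotationSeq` with respect to the first two. -/
def rotationCoeff : ℝ → ℝ → ℝ → ℝ → ℕ → ℝ
  | _, _, x, _, 0 => x
  | κ, κ', x, y, k + 1 => rotationCoeff κ' κ y (κ * y - x) k

theorem root_reflectionPerm_self (i : ι) : P.root (P.reflectionPerm i i) = -P.root i := by
  rw [P.root_reflectionPerm, P.reflection_apply_self]

theorem root_rotationStep (i j : ι) :
    P.root (rotationStep P i j) = -P.reflection j (P.root i) := by
  rw [rotationStep, P.root_reflectionPerm, root_reflectionPerm_self, map_neg]

theorem reflection_reflectionPerm_self (i : ι) :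
    P.reflection (P.reflectionPerm i i) = P.reflection i :=
  reflection_eq_of_root_eq_neg (root_reflectionPerm_self i)

theorem reflection_mul_self (i : ι) : P.reflection i * P.reflection i = 1 := by
  rw [← pow_two, P.reflection_sq]

theorem reflection_rotationStep_mul (i j : ι) :
    P.reflection (rotationStep P i j) * P.reflection j = P.reflection j * P.reflection i := by
  rw [rotationStep, P.reflection_reflectionPerm, reflection_reflectionPerm_self, mul_assoc,
    reflection_mul_self, mul_one]

theorem rotationSeq_zero (i j : ι) : rotationSeq P i j 0 = i := rfl

theorem rotationSeq_add_two (i j : ι) (k : ℕ) : rotationSeq P i j (k + 2) =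
    rotationStep P (rotationSeq P i j k) (rotationSeq P i j (k + 1)) := by
  induction k generalizing i j with
  | zero => rfl
  | succ k ih => exact ih j (rotationStep P i j)

theorem reflection_rotationSeq_succ_mul (i j : ι) (k : ℕ) :
    P.reflection (rotationSeq P i j (k + 1)) * P.reflection (rotationSeq P i j k) =
      P.reflection j * P.reflection i := by
  induction k with
  | zero => rfl
  | succ k ih => rw [rotationSeq_add_two, reflection_rotationStep_mul, ih]

/-- Consecutive reflections always have the same product, and the intermediate reflections cancel.
So the pairs at distance `m` all give the same rotation. -/
theorem reflection_rotationSeq_add_mul (i j : ι) (k m : ℕ) :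
    P.reflection (rotationSeq P i j (k + m)) * P.reflection (rotationSeq P i j k) =
      (P.reflection j * P.reflection i) ^ m := by
  induction m with
  | zero => rw [add_zero, reflection_mul_self, pow_zero]
  | succ m ih =>
    rw [pow_succ', ← ih, ← reflection_rotationSeq_succ_mul i j (k + m), mul_assoc,
      ← mul_assoc (P.reflection (rotationSeq P i j (k + m))), reflection_mul_self, one_mul]
    rfl

theorem root_rotationSeq_add_two (i j : ι) (k : ℕ) : P.root (rotationSeq P i j (k + 2)) =
    (P.reflection j * P.reflection i) (P.root (rotationSeq P i j k)) := by
  rw [rotationSeq_add_two, root_rotationStep, ← reflection_rotationSeq_succ_mul i j k,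
    LinearEquiv.mul_apply, P.reflection_apply_self, map_neg]

theorem root_rotationSeq_add_two_mul (i j : ι) (k m : ℕ) :
    P.root (rotationSeq P i j (k + 2 * m)) =
      ((P.reflection j * P.reflection i) ^ m) (P.root (rotationSeq P i j k)) := by
  induction m with
  | zero => rfl
  | succ m ih =>
    rw [pow_succ', LinearEquiv.mul_apply, ← ih, ← root_rotationSeq_add_two]
    rfl

/-- Identifies the argument `s_α β` of the functional equation as another member of the sequence, up
to sign. -/
theorem reflection_rotationSeq_apply_root (i j : ι) (k m : ℕ) :
    P.reflection (rotationSeq P i j (k + m)) (P.root (rotationSeq P i j k)) =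
      -P.root (rotationSeq P i j (k + 2 * m)) := by
  rw [root_rotationSeq_add_two_mul, ← reflection_rotationSeq_add_mul i j k m,
    LinearEquiv.mul_apply, P.reflection_apply_self, map_neg, neg_neg]

theorem pairing_rotationStep_left (i j : ι) :
    P.pairing (rotationStep P i j) j = P.pairing i j := by
  rw [rotationStep, ← P.pairing_reflectionPerm, P.pairing_reflectionPerm_self_right,
    P.pairing_reflectionPerm_self_left, neg_neg]

theorem pairing_rotationStep_right (i j : ι) :
    P.pairing j (rotationStep P i j) = P.pairing j i := by
  rw [rotationStep, P.pairing_reflectionPerm, P.pairing_reflectionPerm_self_left,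
    P.pairing_reflectionPerm_self_right, neg_neg]

theorem root_rotationStep_eq (i j : ι) :
    P.root (rotationStep P i j) = P.pairing i j • P.root j - P.root i := by
  rw [root_rotationStep, P.reflection_apply_root, neg_sub]

theorem root_rotationSeq {i j : ι} {κ κ' : ℝ} (h : P.pairing i j = κ) (h' : P.pairing j i = κ')
    {a b : V} {x y x' y' : ℝ} (hi : P.root i = x • a + x' • b) (hj : P.root j = y • a + y' • b)
    (k : ℕ) : P.root (rotationSeq P i j k) =
      rotationCoeff κ κ' x y k • a + rotationCoeff κ κ' x' y' k • b := by
  induction k generalizing i j κ κ' x y x' y' with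
  | zero => exact hi
  | succ k ih =>
    refine ih ((pairing_rotationStep_right i j).trans h')
      ((pairing_rotationStep_left i j).trans h) hj ?_
    rw [root_rotationStep_eq, h, hi, hj]
    module

open Classical in
/-- The index of the positive root among `± α_i`. -/
def posIndex (P : RootPairing ι ℝ V N) (ℓ : V →ₗ[ℝ] ℝ) (i : ι) : ι :=
  if 0 < ℓ (P.root i) then i else P.reflectionPerm i i

theorem root_posIndex (ℓ : V →ₗ[ℝ] ℝ) (i : ι) :
    P.root (posIndex P ℓ i) = P.root i ∨ P.root (posIndex P ℓ i) = -P.root i := by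
  unfold posIndex
  split_ifs
  · exact Or.inl rfl
  · exact Or.inr (root_reflectionPerm_self i)

theorem posIndex_pos {ℓ : V →ₗ[ℝ] ℝ} (hℓ : ∀ i, ℓ (P.root i) ≠ 0) (i : ι) :
    0 < ℓ (P.root (posIndex P ℓ i)) := by
  unfold posIndex
  split_ifs with h
  · exact h
  · rw [root_reflectionPerm_self, map_neg, neg_pos]
    exact lt_of_le_of_ne (not_lt.mp h) (hℓ i)

theorem posIndex_eq {ℓ : V →ₗ[ℝ] ℝ} (hℓ : ∀ i, ℓ (P.root i) ≠ 0) {i j : ι}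
    (hi : 0 < ℓ (P.root i)) (h : P.root i = P.root j ∨ P.root i = -P.root j) :
    posIndex P ℓ j = i := by
  have hj := posIndex_pos hℓ j
  have : P.root (posIndex P ℓ j) = P.root i ∨ P.root (posIndex P ℓ j) = -P.root i := by
    rcases root_posIndex (P := P) ℓ j with h1 | h1 <;> rcases h with h2 | h2 <;>
      simp only [h1, h2, neg_neg, true_or, or_true]
  rcases this with h1 | h1
  · exact P.root.injective h1
  · rw [h1, map_neg] at hj
    linarith

theorem reflection_posIndex (ℓ : V →ₗ[ℝ] ℝ) (i : ι) :
    P.reflection (posIndex P ℓ i) = P.reflection i := by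
  rcases root_posIndex (P := P) ℓ i with h | h
  · rw [P.root.injective h]
  · exact reflection_eq_of_root_eq_neg h

/-- The sum over the pairs of positive roots with a given product of reflections, written as a sum
over the roots of a rotation sequence. -/
theorem sum_rotationPairs [Fintype ι] [P.IsReduced] (hP : IsOrthogonal P) {ℓ : V →ₗ[ℝ] ℝ}
    (hℓ : ∀ i, ℓ (P.root i) ≠ 0) {i j : ι} {n m : ℕ}
    (hdist : ∀ k < n, ∀ l < n, P.root (rotationSeq P i j k) = P.root (rotationSeq P i j l) ∨
      P.root (rotationSeq P i j k) = -P.root (rotationSeq P i j l) → k = l)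
    (hli : LinearIndependent ℝ ![P.root (rotationSeq P i j m), P.root i])
    (hcomp : ∀ l, P.root l ∈ Submodule.span ℝ {P.root (rotationSeq P i j m), P.root i} →
      ∃ k < n, P.root l = P.root (rotationSeq P i j k) ∨
        P.root l = -P.root (rotationSeq P i j k))
    (T : ι → ι → ℂ) (hT₁ : ∀ k l, T (P.reflectionPerm k k) l = T k l)
    (hT₂ : ∀ k l, T k (P.reflectionPerm l l) = T k l) :
    ∑ p ∈ rotationPairs P ℓ (P.reflection (rotationSeq P i j m) * P.reflection i), T p.1 p.2 =
      ∑ k ∈ Finset.range n, T (rotationSeq P i j (k + m)) (rotationSeq P i j k) := by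
  set g := rotationSeq P i j with hg
  have hmul (k : ℕ) : P.reflection (g (k + m)) * P.reflection (g k) =
      P.reflection (g m) * P.reflection i := by
    have h0 := reflection_rotationSeq_add_mul (P := P) i j 0 m
    rw [zero_add, rotationSeq_zero] at h0
    rw [hg, reflection_rotationSeq_add_mul, h0]
  have hTpos (k l : ι) : T (posIndex P ℓ k) (posIndex P ℓ l) = T k l := by
    unfold posIndex
    split_ifs <;> simp only [hT₁, hT₂]
  symm
  refine Finset.sum_bij (fun k _ ↦ (posIndex P ℓ (g (k + m)), posIndex P ℓ (g k)))
    (fun k _ ↦ ?_) (fun k hk l hl hkl ↦ ?_) (fun p hp ↦ ?_) (fun k _ ↦ ?_)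
  · simp only [rotationPairs, Finset.mem_filter]
    refine ⟨Finset.mem_univ _, posIndex_pos hℓ _, posIndex_pos hℓ _, ?_⟩
    rw [reflection_posIndex, reflection_posIndex, hmul]
  · refine hdist k (Finset.mem_range.mp hk) l (Finset.mem_range.mp hl) ?_
    have h1 := (Prod.mk.inj hkl).2
    refine reflection_eq_iff.mp ?_
    rw [← reflection_posIndex ℓ, h1, reflection_posIndex]
  · simp only [rotationPairs, Finset.mem_filter] at hp
    obtain ⟨-, h1, h2, h3⟩ := hp
    obtain ⟨k, hk, h4⟩ := hcomp p.2 (hP.root_mem_span_of_mul_eq hli h3)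
    refine ⟨k, Finset.mem_range.mpr hk, Prod.ext ?_ ?_⟩
    · refine posIndex_eq hℓ h1 (reflection_eq_iff.mp ?_)
      rw [reflection_eq_iff.mpr h4, ← hmul k] at h3
      exact mul_right_cancel h3
    · exact posIndex_eq hℓ h2 h4
  · exact (hTpos _ _).symm

/-- Points near the origin off the reflection hyperplanes realize all small coordinates with respect
to two independent roots at which no root of their plane vanishes. -/
theorem exists_regular_point [Finite ι] {i j : ι}
    (hli : LinearIndependent ℝ ![P.root i, P.root j]) {S : Set V} (hS : S ∈ 𝓝 (0 : V)) :
    ∃ ε > 0, ∀ s t : ℝ, |s| < ε → |t| < ε →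
      (∀ l, P.root l ∈ Submodule.span ℝ {P.root i, P.root j} →
        ∀ x, inner ℝ (P.root i) x = s → inner ℝ (P.root j) x = t → inner ℝ (P.root l) x ≠ 0) →
      ∃ x ∈ S, (∀ l, inner ℝ (P.root l) x ≠ 0) ∧ inner ℝ (P.root i) x = s ∧
        inner ℝ (P.root j) x = t := by
  set a := P.root i
  set b := P.root j
  have hdual : ∃ u w : V, inner ℝ a u = 1 ∧ inner ℝ b u = 0 ∧ inner ℝ a w = 0 ∧
      inner ℝ b w = 1 := by
    have key : ∀ a b : V, LinearIndependent ℝ ![a, b] → ∃ u, inner ℝ a u = 1 ∧ inner ℝ b u = 0 := by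
      intro a b hab
      have hnot : a ∉ (Submodule.span ℝ {b}) := by
        intro hmem
        obtain ⟨c, hc⟩ := Submodule.mem_span_singleton.mp hmem
        have := LinearIndependent.pair_iff.mp hab 1 (-c) (by rw [one_smul, neg_smul, hc]; abel)
        exact one_ne_zero this.1
      have h2 : (Submodule.span ℝ {b})ᗮᗮ = Submodule.span ℝ {b} :=
        Submodule.orthogonal_orthogonal _
      rw [← h2, Submodule.mem_orthogonal] at hnot
      push Not at hnot
      obtain ⟨u, hu, hne⟩ := hnot
      rw [real_inner_comm] at hne
      refine ⟨(inner ℝ a u)⁻¹ • u, ?_, ?_⟩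
      · rw [inner_smul_right, inv_mul_cancel₀ hne]
      · rw [inner_smul_right, Submodule.mem_orthogonal_singleton_iff_inner_right.mp hu, mul_zero]
    obtain ⟨u, hu⟩ := key a b hli
    obtain ⟨w, hw⟩ := key b a (LinearIndependent.pair_symm_iff.mp hli)
    exact ⟨u, w, hu.1, hu.2, hw.2, hw.1⟩
  obtain ⟨u, w, hau, hbu, haw, hbw⟩ := hdual
  -- A direction orthogonal to the plane along which no root outside the plane vanishes; it exists
  -- because finitely many proper subspaces do not cover.
  obtain ⟨y, hyK, hy⟩ := Module.Dual.exists_forall_mem_ne_zero_of_forall_exists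
    (Submodule.span ℝ {a, b})ᗮ
    (fun l : {l : ι // P.root l ∉ Submodule.span ℝ {a, b}} ↦
      ((innerSL ℝ (P.root l.1) : V →L[ℝ] ℝ) : V →ₗ[ℝ] ℝ)) (by
        rintro ⟨l, hl⟩
        rw [← span_pair_orthogonal_orthogonal, Submodule.mem_orthogonal] at hl
        push Not at hl
        obtain ⟨x, hx, hne⟩ := hl
        rw [real_inner_comm] at hne
        exact ⟨x, hx, hne⟩)
  rw [mem_span_pair_orthogonal] at hyK
  have hcont : Tendsto (fun p : ℝ × ℝ × ℝ ↦ p.1 • u + p.2.1 • w + p.2.2 • y) (𝓝 0) (𝓝 0) := by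
    refine Continuous.tendsto' (by fun_prop) _ _ (by simp)
  obtain ⟨ε, hε, hball⟩ := Metric.mem_nhds_iff.mp (hcont hS)
  refine ⟨ε, hε, fun s t hs ht hreg ↦ ?_⟩
  have hin (τ : ℝ) : inner ℝ a (s • u + t • w + τ • y) = s ∧
      inner ℝ b (s • u + t • w + τ • y) = t := by
    simp [inner_add_right, inner_smul_right, hau, hbu, haw, hbw, hyK]
  have hev : ∀ᶠ τ in 𝓝[≠] (0 : ℝ), ∀ l, inner ℝ (P.root l) (s • u + t • w + τ • y) ≠ 0 := by
    rw [eventually_all]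
    intro l
    by_cases hl : P.root l ∈ Submodule.span ℝ {a, b}
    · exact Eventually.of_forall fun τ ↦ hreg l hl _ (hin τ).1 (hin τ).2
    · have hly : inner ℝ (P.root l) y ≠ 0 := hy ⟨l, hl⟩
      simp only [inner_add_right _ (s • u + t • w), inner_smul_right (P.root l) y]
      by_cases h0 : inner ℝ (P.root l) (s • u + t • w) = 0
      · filter_upwards [self_mem_nhdsWithin] with τ hτ
        rw [h0, zero_add]
        exact mul_ne_zero hτ hly
      · have hc : ContinuousAt
          (fun τ : ℝ ↦ inner ℝ (P.root l) (s • u + t • w) + τ * inner ℝ (P.root l) y) 0 := by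
          fun_prop
        exact (hc.eventually_ne (by simpa using h0)).filter_mono nhdsWithin_le_nhds
  have hτε : ∀ᶠ τ in 𝓝[≠] (0 : ℝ), |τ| < ε :=
    (continuous_abs.tendsto' (0 : ℝ) 0 abs_zero).eventually_lt_const hε |>.filter_mono
      nhdsWithin_le_nhds
  obtain ⟨τ, hτ1, hτ2⟩ := (hev.and hτε).exists
  refine ⟨s • u + t • w + τ • y, ?_, hτ1, hin τ⟩
  have hmem : ((s, t, τ) : ℝ × ℝ × ℝ) ∈ Metric.ball (0 : ℝ × ℝ × ℝ) ε := by
    simp [Prod.norm_def, hs, ht, hτ2]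
  exact hball hmem

end GeneralizedDunkl

end

/-! ### The functional equation of a plane as an identity in two variables -/

noncomputable section

namespace GeneralizedDunkl

variable {ι V N : Type*} [NormedAddCommGroup V] [InnerProductSpace ℝ V]
  [AddCommGroup N] [Module ℝ N] {P : RootPairing ι ℝ V N}

/-- A family of odd, Weyl group invariant germs of functions of one real variable which solve the
functional equations. -/
structure IsInvariantSolution [Fintype ι] (P : RootPairing ι ℝ V N) (ℓ : V →ₗ[ℝ] ℝ) (φ : ι → ℝ → ℂ) :
    Prop where
  odd (i : ι) : ∀ᶠ t in 𝓝[≠] (0 : ℝ), φ i (-t) = -φ i t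
  invariant (i j : ι) : ∀ᶠ t in 𝓝[≠] (0 : ℝ), φ (P.reflectionPerm i j) t = φ j t
  equation (r : V ≃ₗ[ℝ] V) (e₁ e₂ : V) : IsRotationPlaneBasis r e₁ e₂ →
    ∀ᶠ x in 𝓝 (0 : V), (∀ i, inner ℝ (P.root i) x ≠ 0) →
      ∑ p ∈ rotationPairs P ℓ r, (orientedArea e₁ e₂ (P.root p.1) (P.root p.2) : ℂ) *
        φ p.1 (inner ℝ (P.root p.1) x) *
          φ p.2 (inner ℝ (P.reflection p.1 (P.root p.2)) x) = 0

theorem eventually_forall_inner_root [Finite ι] {Q : ℝ → Prop} (hQ : ∀ᶠ t in 𝓝[≠] (0 : ℝ), Q t) :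
    ∀ᶠ x in 𝓝 (0 : V), ∀ l, inner ℝ (P.root l) x ≠ 0 → Q (inner ℝ (P.root l) x) := by
  rw [eventually_all]
  intro l
  have hc : Tendsto (fun x : V ↦ inner ℝ (P.root l) x) (𝓝 0) (𝓝 (0 : ℝ)) :=
    Continuous.tendsto' (by fun_prop) _ _ (inner_zero_right _)
  exact hc.eventually (eventually_nhdsWithin_iff.mp hQ)

/-- Up to sign each root is a reflection of its second predecessor, and signs are reflections too,
so only parity matters. -/
theorem apply_rotationSeq {φ : ι → ℝ → ℂ} {z : ℝ}
    (h : ∀ i j, φ (P.reflectionPerm i j) z = φ j z) (i j : ι) (k : ℕ) :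
    φ (rotationSeq P i j k) z = if Even k then φ i z else φ j z := by
  induction k generalizing i j with
  | zero => simp [rotationSeq_zero]
  | succ k ih =>
    rw [rotationSeq, ih, rotationStep, h, h]
    by_cases hk : Even k <;> simp [hk, Nat.even_add_one]

/-- The `n` lines of roots in the plane are indexed by `k`, and the pair `(k + m, k)` contributes
the `k`-th term. Oddness makes the summands insensitive to signs, so positivity of roots plays no
further role; regular points realize all small values `s`, `t` of the two base roots. -/
theorem IsInvariantSolution.sum_rotationSeq_eq_zero [Fintype ι] [P.IsReduced] {ℓ : V →ₗ[ℝ] ℝ} {φ : ι → ℝ → ℂ}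
    (h : IsInvariantSolution P ℓ φ) (hP : IsOrthogonal P) (hℓ : ∀ i, ℓ (P.root i) ≠ 0) {i j : ι}
    {κ κ' : ℝ} (hκ : P.pairing i j = κ) (hκ' : P.pairing j i = κ')
    (hli : LinearIndependent ℝ ![P.root i, P.root j]) {c d : ℕ → ℝ}
    (hc : ∀ k, rotationCoeff κ κ' 1 0 k = c k) (hd : ∀ k, rotationCoeff κ κ' 0 1 k = d k)
    {n m : ℕ} (hdist : ∀ k < n, ∀ l < n, c k * d l = d k * c l → k = l) (hm : d m ≠ 0)
    (hcomp : ∀ l, P.root l ∈ Submodule.span ℝ {P.root i, P.root j} →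
      ∃ k < n, P.root l = c k • P.root i + d k • P.root j ∨
        P.root l = -(c k • P.root i + d k • P.root j)) :
    ∃ ε > 0, ∀ s t : ℝ, |s| < ε → |t| < ε → (∀ k < n, c k * s + d k * t ≠ 0) →
      ∑ k ∈ Finset.range n, ((c (k + m) * d k - d (k + m) * c k : ℝ) : ℂ) *
        (if Even (k + m) then φ i else φ j) (c (k + m) * s + d (k + m) * t) *
          (if Even k then φ i else φ j) (c (k + 2 * m) * s + d (k + 2 * m) * t) = 0 := by
  set a := P.root i
  set b := P.root j
  have hroot (k : ℕ) : P.root (rotationSeq P i j k) = c k • a + d k • b := by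
    rw [← hc, ← hd]
    exact root_rotationSeq hκ hκ' (by simp [a]) (by simp [b]) k
  have hspan : Submodule.span ℝ {P.root (rotationSeq P i j m), a} = Submodule.span ℝ {a, b} := by
    apply le_antisymm <;> rw [Submodule.span_le, Set.insert_subset_iff, Set.singleton_subset_iff]
    · refine ⟨Submodule.mem_span_pair.mpr ⟨c m, d m, (hroot m).symm⟩,
        Submodule.subset_span (by simp)⟩
    · refine ⟨Submodule.subset_span (by simp), Submodule.mem_span_pair.mpr
        ⟨(d m)⁻¹, -((d m)⁻¹ * c m), ?_⟩⟩
      rw [hroot]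
      match_scalars <;> field_simp
      ring
  have hpair {c₁ d₁ c₂ d₂ : ℝ} (he : c₁ • a + d₁ • b = c₂ • a + d₂ • b) : c₁ = c₂ ∧ d₁ = d₂ := by
    have := LinearIndependent.pair_iff.mp hli (c₁ - c₂) (d₁ - d₂) (by
      rw [← sub_eq_zero.mpr he]; module)
    exact ⟨sub_eq_zero.mp this.1, sub_eq_zero.mp this.2⟩
  have hli' : LinearIndependent ℝ ![P.root (rotationSeq P i j m), a] := by
    rw [LinearIndependent.pair_iff]
    intro u v huv
    rw [hroot] at huv
    have := LinearIndependent.pair_iff.mp hli (u * c m + v) (u * d m) (by rw [← huv]; module)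
    have hu := (mul_eq_zero.mp this.2).resolve_right hm
    exact ⟨hu, by simpa [hu] using this.1⟩
  obtain ⟨e₁, e₂, ho, hs, harea⟩ := exists_orthonormal_span_pair hli'
  have hQ : ∀ᶠ t in 𝓝[≠] (0 : ℝ), (∀ i, φ i (-t) = -φ i t) ∧
      ∀ i j, φ (P.reflectionPerm i j) t = φ j t := by
    simp only [eventually_and, eventually_all]
    exact ⟨h.odd, h.invariant⟩
  obtain ⟨ε, hε, hreg⟩ := exists_regular_point hli
    ((h.equation _ e₁ e₂ (hP.isRotationPlaneBasis hli' ho hs)).and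
      (eventually_forall_inner_root (P := P) hQ))
  refine ⟨ε, hε, fun s t hsε htε hst ↦ ?_⟩
  obtain ⟨x, ⟨hx1, hx2⟩, hx, hsx, htx⟩ := hreg s t hsε htε (fun l hl x hsx htx ↦ by
    change inner ℝ a x = s at hsx
    change inner ℝ b x = t at htx
    have hk' (k : ℕ) : inner ℝ (c k • a + d k • b) x = c k * s + d k * t := by
      rw [inner_add_left, real_inner_smul_left, real_inner_smul_left, hsx, htx]
    obtain ⟨k, hk, h1 | h1⟩ := hcomp l hl
    · rw [h1, hk']
      exact hst k hk
    · rw [h1, inner_neg_left, hk', neg_ne_zero]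
      exact hst k hk)
  have hodd (l k : ι) : φ l (-inner ℝ (P.root k) x) = -φ l (inner ℝ (P.root k) x) :=
    (hx2 k (hx k)).1 l
  have hinv (l k p : ι) : φ (P.reflectionPerm l k) (inner ℝ (P.root p) x) =
      φ k (inner ℝ (P.root p) x) := (hx2 p (hx p)).2 l k
  have hsum := hx1 hx
  rw [sum_rotationPairs hP hℓ (n := n) (fun k hk l hl hkl ↦ hdist k hk l hl ?_) hli'
    (fun l hl ↦ ?_) (fun k l ↦ (orientedArea e₁ e₂ (P.root k) (P.root l) : ℂ) *
        φ k (inner ℝ (P.root k) x) * φ l (inner ℝ (P.reflection k (P.root l)) x))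
    (fun k l ↦ ?_) (fun k l ↦ ?_)] at hsum
  · have hA := orientedArea_smul_add_smul e₁ e₂ a b
    have hA0 : orientedArea e₁ e₂ a b ≠ 0 := by
      intro h0
      apply harea
      have h1 := hA (c m) (d m) 1 0
      rw [one_smul, zero_smul, add_zero, ← hroot] at h1
      rw [h1, h0, mul_zero]
    have hz (k : ℕ) : inner ℝ (P.root (rotationSeq P i j k)) x = c k * s + d k * t := by
      rw [hroot, inner_add_left, real_inner_smul_left, real_inner_smul_left, hsx, htx]
    have hseq (k l : ℕ) : φ (rotationSeq P i j k) (c l * s + d l * t) =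
        (if Even k then φ i else φ j) (c l * s + d l * t) := by
      rw [← hz, apply_rotationSeq (fun p q ↦ hinv p q _)]
      split_ifs <;> rfl
    -- All areas are multiples of the area of the base roots; the minus sign comes from `s_{k+m} α_k
    -- = -α_{k+2m}` and oddness.
    refine (mul_eq_zero.mp (?_ : (-orientedArea e₁ e₂ a b : ℂ) * _ = 0)).resolve_left
      (neg_ne_zero.mpr (by exact_mod_cast hA0))
    rw [Finset.mul_sum, ← hsum]
    refine Finset.sum_congr rfl fun k _ ↦ ?_
    rw [reflection_rotationSeq_apply_root, inner_neg_left, hodd, hz, hz, hseq, hseq, hroot, hroot,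
      hA]
    push_cast
    ring
  · rw [hroot, hroot, ← neg_one_smul ℝ (c l • a + d l • b), smul_add, smul_smul, smul_smul] at hkl
    rcases hkl with h1 | h1 <;> obtain ⟨h2, h3⟩ := hpair h1 <;> rw [h2, h3] <;> ring
  · rw [hspan] at hl
    simpa only [hroot] using hcomp l hl
  · have : inner ℝ (P.root (P.reflectionPerm k k)) x = -inner ℝ (P.root k) x := by
      rw [root_reflectionPerm_self, inner_neg_left]
    rw [hinv, reflection_reflectionPerm_self, this, hodd, root_reflectionPerm_self,
      orientedArea_neg_left]
    push_cast
    ring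
  · have : P.reflection k (P.root l) = P.root (P.reflectionPerm k l) :=
      (P.root_reflectionPerm k l).symm
    have h2 : inner ℝ (P.reflection k (P.root (P.reflectionPerm l l))) x =
        -inner ℝ (P.root (P.reflectionPerm k l)) x := by
      rw [root_reflectionPerm_self, map_neg, inner_neg_left, this]
    rw [h2, this, hodd, hinv, root_reflectionPerm_self, orientedArea_neg_right]
    push_cast
    ring

end GeneralizedDunkl

end

/-! ### Planes of type A₂, B₂ and G₂ -/

noncomputable section

namespace GeneralizedDunkl

/-- The germ at `0` of a function is a multiple of `1 / t`. -/
def IsMultipleOfInv (F : ℝ → ℂ) : Prop :=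
  ∃ k : ℂ, ∀ᶠ t in 𝓝[≠] (0 : ℝ), F t = k / t

theorem IsMultipleOfInv.congr {F G : ℝ → ℂ} (hF : IsMultipleOfInv F)
    (h : ∀ᶠ t in 𝓝[≠] (0 : ℝ), G t = F t) : IsMultipleOfInv G := by
  obtain ⟨k, hk⟩ := hF
  exact ⟨k, by filter_upwards [h, hk] with t h1 h2 using h1.trans h2⟩

theorem exists_forall_abs_lt_of_eventually {Q : ℝ → Prop} (h : ∀ᶠ t in 𝓝[≠] (0 : ℝ), Q t) :
    ∃ δ > 0, ∀ t, |t| < δ → t ≠ 0 → Q t := by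
  obtain ⟨δ, hδ, hQ⟩ := Metric.eventually_nhds_iff.mp (eventually_nhdsWithin_iff.mp h)
  exact ⟨δ, hδ, fun t ht ht0 ↦ hQ (by simpa using ht) ht0⟩

theorem eventually_abs_lt {δ : ℝ} (hδ : 0 < δ) : ∀ᶠ t in 𝓝[≠] (0 : ℝ), |t| < δ :=
  (continuous_abs.tendsto' (0 : ℝ) 0 abs_zero).eventually_lt_const hδ |>.filter_mono
    nhdsWithin_le_nhds

theorem MeromorphicAt.eventually_ne_zero {F : ℝ → ℂ} (hF : MeromorphicAt F 0)
    (h0 : ¬ ∀ᶠ t in 𝓝[≠] (0 : ℝ), F t = 0) : ∀ᶠ t in 𝓝[≠] (0 : ℝ), F t ≠ 0 :=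
  hF.eventually_eq_zero_or_eventually_ne_zero.resolve_left h0

variable {ι V N : Type*} [Fintype ι] [NormedAddCommGroup V] [InnerProductSpace ℝ V]
  [AddCommGroup N] [Module ℝ N] {P : RootPairing ι ℝ V N} {ℓ : V →ₗ[ℝ] ℝ} {φ : ι → ℝ → ℂ}
  {i j : ι}

/-- At `(α_i, x) = t`, `(α_j, x) = 2t` the third root also takes the value `t`, and the equation
becomes `F(t) (2 F(2t) - F(t)) = 0`. -/
theorem IsInvariantSolution.isMultipleOfInv_of_simplyLaced [P.IsReduced]
    (h : IsInvariantSolution P ℓ φ) (hP : IsOrthogonal P) (hℓ : ∀ i, ℓ (P.root i) ≠ 0)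
    (hκ : P.pairing i j = 1) (hκ' : P.pairing j i = 1)
    (hli : LinearIndependent ℝ ![P.root i, P.root j])
    (hcomp : ∀ l, P.root l ∈ Submodule.span ℝ {P.root i, P.root j} →
      ∃ k < 3, P.root l = rotationCoeff 1 1 1 0 k • P.root i + rotationCoeff 1 1 0 1 k • P.root j ∨
        P.root l = -(rotationCoeff 1 1 1 0 k • P.root i + rotationCoeff 1 1 0 1 k • P.root j))
    (hF : MeromorphicAt (φ i) 0) (hF0 : ¬ ∀ᶠ t in 𝓝[≠] (0 : ℝ), φ i t = 0) :
    IsMultipleOfInv (φ i) := by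
  have hji : ∀ᶠ t in 𝓝[≠] (0 : ℝ), φ j t = φ i t := by
    -- `s_i s_j α_i = -α_j`: all roots of an A₂ plane are conjugate.
    have hr : P.reflectionPerm i (P.reflectionPerm j i) = P.reflectionPerm j j := by
      apply P.root.injective
      rw [P.root_reflectionPerm, P.root_reflectionPerm, root_reflectionPerm_self,
        P.reflection_apply_root, map_sub, map_smul, P.reflection_apply_self,
        P.reflection_apply_root, hκ, hκ']
      module
    filter_upwards [h.invariant j j, h.invariant j i, h.invariant i (P.reflectionPerm j i)]
      with t h1 h2 h3
    rw [← h1, ← hr, h3, h2]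
  obtain ⟨ε, hε, heq⟩ := h.sum_rotationSeq_eq_zero hP hℓ hκ hκ' hli (fun _ ↦ rfl) (fun _ ↦ rfl)
    (n := 3) (m := 1) (fun k hk l hl ↦ by
      interval_cases k <;> interval_cases l <;> norm_num [rotationCoeff])
    (by norm_num [rotationCoeff]) hcomp
  refine MeromorphicAt.exists_eq_div_of_comp_two_mul hF ?_
  filter_upwards [MeromorphicAt.eventually_ne_zero hF hF0, h.odd i,
    eventually_comp_mul_left_nhdsNE (h.odd i) two_ne_zero, hji,
    eventually_comp_mul_left_nhdsNE hji two_ne_zero,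
    eventually_comp_mul_left_nhdsNE hji (neg_ne_zero.mpr one_ne_zero),
    eventually_abs_lt hε,
    eventually_comp_mul_left_nhdsNE (eventually_abs_lt hε) two_ne_zero, self_mem_nhdsWithin]
    with t hne ho ho2 hj hj2 hj3 ht ht2 ht0
  have ht0' : t ≠ 0 := ht0
  have := heq t (2 * t) ht ht2 (fun k hk ↦ by
    interval_cases k <;> norm_num [rotationCoeff] <;> first | exact ht0' | skip
    intro h0
    apply ht0'
    linarith)
  norm_num [Finset.sum_range_succ, rotationCoeff, Nat.even_add_one] at this
  rw [neg_one_mul] at hj3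
  simp only [show -t + 2 * t = t by ring] at this
  rw [hj2, hj3, ho, ho2] at this
  refine mul_left_cancel₀ hne ?_
  linear_combination -this

/-- With `s`, `t` the values of the short root `α_i` and the long root `α_j`, the remaining lines
carry the short value `t - s` and the long value `t - 2s`. -/
theorem IsInvariantSolution.exists_equation_B₂ [P.IsReduced]
    (h : IsInvariantSolution P ℓ φ) (hP : IsOrthogonal P) (hℓ : ∀ i, ℓ (P.root i) ≠ 0)
    (hκ : P.pairing i j = 1) (hκ' : P.pairing j i = 2)
    (hli : LinearIndependent ℝ ![P.root i, P.root j])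
    (hcomp : ∀ l, P.root l ∈ Submodule.span ℝ {P.root i, P.root j} →
      ∃ k < 4, P.root l = rotationCoeff 1 2 1 0 k • P.root i + rotationCoeff 1 2 0 1 k • P.root j ∨
        P.root l = -(rotationCoeff 1 2 1 0 k • P.root i + rotationCoeff 1 2 0 1 k • P.root j)) :
    ∃ ε > 0, ∀ s t : ℝ, |s| < ε → |t| < ε → s ≠ 0 → t ≠ 0 → t - s ≠ 0 → t - 2 * s ≠ 0 →
      φ j t * (φ i (t - s) + φ i s) + φ j (t - 2 * s) * (φ i (t - s) - φ i s) = 0 := by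
  obtain ⟨ε, hε, heq⟩ := h.sum_rotationSeq_eq_zero hP hℓ hκ hκ' hli (fun _ ↦ rfl) (fun _ ↦ rfl)
    (n := 4) (m := 1) (fun k hk l hl ↦ by
      interval_cases k <;> interval_cases l <;> norm_num [rotationCoeff])
    (by norm_num [rotationCoeff]) hcomp
  obtain ⟨δ, hδ, hodd⟩ := exists_forall_abs_lt_of_eventually ((h.odd i).and (h.odd j))
  refine ⟨min ε δ, lt_min hε hδ, fun s t hs ht h0 h1 h2 h3 ↦ ?_⟩
  rw [lt_min_iff] at hs ht
  have := heq s t hs.1 ht.1 (fun k hk ↦ by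
    interval_cases k
    · simpa [rotationCoeff] using h0
    · simpa [rotationCoeff] using h1
    · convert h2 using 1
      norm_num [rotationCoeff]
      ring
    · convert h3 using 1
      norm_num [rotationCoeff]
      ring)
  norm_num [Finset.sum_range_succ, rotationCoeff, Nat.even_add_one] at this
  rw [show -s + t = t - s by ring, show -(2 * s) + t = t - 2 * s by ring,
    (hodd s hs.2 h0).1, (hodd t ht.2 h1).2] at this
  linear_combination -this

/-- In a plane of type `B₂`, if one of the two functions is a nonzero multiple of `1 / t`, then the
other one is a multiple of `1 / t`. -/
theorem IsInvariantSolution.isMultipleOfInv_long_iff_short [P.IsReduced]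
    (h : IsInvariantSolution P ℓ φ) (hP : IsOrthogonal P) (hℓ : ∀ i, ℓ (P.root i) ≠ 0)
    (hκ : P.pairing i j = 1) (hκ' : P.pairing j i = 2)
    (hli : LinearIndependent ℝ ![P.root i, P.root j])
    (hcomp : ∀ l, P.root l ∈ Submodule.span ℝ {P.root i, P.root j} →
      ∃ k < 4, P.root l = rotationCoeff 1 2 1 0 k • P.root i + rotationCoeff 1 2 0 1 k • P.root j ∨
        P.root l = -(rotationCoeff 1 2 1 0 k • P.root i + rotationCoeff 1 2 0 1 k • P.root j))
    (hF : ∀ i, MeromorphicAt (φ i) 0) (hF0 : ∀ i, ¬ ∀ᶠ t in 𝓝[≠] (0 : ℝ), φ i t = 0) :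
    IsMultipleOfInv (φ j) ↔ IsMultipleOfInv (φ i) := by
  obtain ⟨ε, hε, heq⟩ := h.exists_equation_B₂ hP hℓ hκ hκ' hli hcomp
  constructor
  · rintro ⟨q, hq⟩
    have hq0 : q ≠ 0 := by
      rintro rfl
      exact hF0 j (by filter_upwards [hq] with t ht; rw [ht, zero_div])
    refine MeromorphicAt.exists_eq_div_of_comp_two_mul (hF i) ?_
    filter_upwards [hq, eventually_comp_mul_left_nhdsNE hq three_ne_zero, eventually_abs_lt hε,
      eventually_comp_mul_left_nhdsNE (eventually_abs_lt hε) three_ne_zero, self_mem_nhdsWithin]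
      with t h1 h3 hε1 hε3 ht0
    have ht0' : t ≠ 0 := ht0
    have htc : (t : ℂ) ≠ 0 := by exact_mod_cast ht0'
    -- Short values `t`, `2t` and long values `3t`, `t`: the known long function leaves a relation
    -- between the short one at `t` and at `2t`.
    have := heq t (3 * t) hε1 hε3 ht0' (mul_ne_zero three_ne_zero ht0')
      (by rw [show 3 * t - t = 2 * t by ring]; exact mul_ne_zero two_ne_zero ht0')
      (by rwa [show 3 * t - 2 * t = t by ring])
    rw [show 3 * t - t = 2 * t by ring, show 3 * t - 2 * t = t by ring, h1, h3] at this
    push_cast at this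
    generalize φ i (2 * t) = u, φ i t = v at this ⊢
    field_simp at this
    refine mul_left_cancel₀ hq0 ?_
    linear_combination this / 2
  · rintro ⟨p, hp⟩
    have hp0 : p ≠ 0 := by
      rintro rfl
      exact hF0 i (by filter_upwards [hp] with t ht; rw [ht, zero_div])
    refine MeromorphicAt.exists_eq_div_of_comp_two_mul (hF j) ?_
    have hh : (-(1 / 2) : ℝ) ≠ 0 := by norm_num
    have hh' : (3 / 2 : ℝ) ≠ 0 := by norm_num
    filter_upwards [eventually_comp_mul_left_nhdsNE hp hh, eventually_comp_mul_left_nhdsNE hp hh',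
      eventually_abs_lt hε, eventually_comp_mul_left_nhdsNE (eventually_abs_lt hε) hh,
      self_mem_nhdsWithin] with t h1 h3 hε1 hε2 ht0
    have ht0' : t ≠ 0 := ht0
    have htc : (t : ℂ) ≠ 0 := by exact_mod_cast ht0'
    have e1 : t - -(1 / 2) * t = 3 / 2 * t := by ring
    have e2 : t - 2 * (-(1 / 2) * t) = 2 * t := by ring
    -- Long values `t`, `2t` and short values `-t/2`, `3t/2`, with the roles exchanged.
    have := heq (-(1 / 2) * t) t hε2 hε1 (mul_ne_zero hh ht0') ht0'
      (by rw [e1]; exact mul_ne_zero hh' ht0') (by rw [e2]; exact mul_ne_zero two_ne_zero ht0')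
    rw [e1, e2, h1, h3] at this
    push_cast at this
    generalize φ j (2 * t) = u, φ j t = v at this ⊢
    field_simp at this
    refine mul_left_cancel₀ hp0 ?_
    linear_combination this / 4

theorem IsInvariantSolution.solvesG2 [P.IsReduced]
    (h : IsInvariantSolution P ℓ φ) (hP : IsOrthogonal P) (hℓ : ∀ i, ℓ (P.root i) ≠ 0)
    (hκ : P.pairing i j = 1) (hκ' : P.pairing j i = 3)
    (hli : LinearIndependent ℝ ![P.root i, P.root j])
    (hcomp : ∀ l, P.root l ∈ Submodule.span ℝ {P.root i, P.root j} →
      ∃ k < 6, P.root l = rotationCoeff 1 3 1 0 k • P.root i + rotationCoeff 1 3 0 1 k • P.root j ∨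
        P.root l = -(rotationCoeff 1 3 1 0 k • P.root i + rotationCoeff 1 3 0 1 k • P.root j)) :
    SolvesG2 (φ i) (φ j) := by
  have hdist : ∀ k < 6, ∀ l < 6, rotationCoeff 1 3 1 0 k * rotationCoeff 1 3 0 1 l =
      rotationCoeff 1 3 0 1 k * rotationCoeff 1 3 1 0 l → k = l := fun k hk l hl ↦ by
    interval_cases k <;> interval_cases l <;> norm_num [rotationCoeff]
  obtain ⟨ε, hε, heq⟩ := h.sum_rotationSeq_eq_zero hP hℓ hκ hκ' hli (fun _ ↦ rfl) (fun _ ↦ rfl)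
    (n := 6) (m := 1) hdist (by norm_num [rotationCoeff]) hcomp
  obtain ⟨ε', hε', heq'⟩ := h.sum_rotationSeq_eq_zero hP hℓ hκ hκ' hli (fun _ ↦ rfl) (fun _ ↦ rfl)
    (n := 6) (m := 2) hdist (by norm_num [rotationCoeff]) hcomp
  obtain ⟨δ, hδ, hodd⟩ := exists_forall_abs_lt_of_eventually ((h.odd i).and (h.odd j))
  -- The factor `1/3` keeps `X + Y` and `2 Y - X` in the range of the equations and of oddness. The
  -- long base root is `X + Y`.
  refine ⟨min (min ε ε') δ / 3, by positivity, fun X Y hX hY hXY ↦ ?_⟩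
  obtain ⟨h1, h2, h3, h4, h5, h6⟩ := hXY
  obtain ⟨m₁, m₂⟩ := And.intro (min_le_left (min ε ε') δ) (min_le_right (min ε ε') δ)
  obtain ⟨m₃, m₄⟩ := And.intro (min_le_left ε ε') (min_le_right ε ε')
  have hXY1 := abs_add_le X Y
  have hXY2 := abs_sub (2 * Y) X
  rw [abs_mul, abs_two] at hXY2
  have hX0 := abs_nonneg X
  have hY0 := abs_nonneg Y
  have hreg : ∀ k < 6, rotationCoeff 1 3 1 0 k * X + rotationCoeff 1 3 0 1 k * (X + Y) ≠ 0 := by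
    intro k hk
    interval_cases k
    · convert h1 using 1
      norm_num [rotationCoeff]
    · convert h4 using 1
      norm_num [rotationCoeff]
    · convert h2 using 1
      norm_num [rotationCoeff]
    · convert h5 using 1
      norm_num [rotationCoeff]
      ring
    · convert h3 using 1
      norm_num [rotationCoeff]
      ring
    · convert h6 using 1
      norm_num [rotationCoeff]
      ring
  have k1 := heq X (X + Y) (by linarith) (by linarith) hreg
  have k2 := heq' X (X + Y) (by linarith) (by linarith) hreg
  norm_num [Finset.sum_range_succ, rotationCoeff, Nat.even_add_one] at k1 k2
  have e1 : -(3 * X) + 2 * (X + Y) = 2 * Y - X := by ring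
  have e2 : -(2 * X) + (X + Y) = Y - X := by ring
  have e3 : -(3 * X) + (X + Y) = Y - 2 * X := by ring
  have o1 := (hodd X (by linarith) h1).1
  have o2 := (hodd Y (by linarith) h2).1
  have o3 := (hodd (X + Y) (by linarith) h4).2
  have o4 := (hodd (2 * Y - X) (by linarith) h5).2
  have e4 : -Y + -X = -(X + Y) := by ring
  have e5 : 3 * X + -(2 * (X + Y)) = -(2 * Y - X) := by ring
  rw [e1, e2, e3, e4, o1, o3] at k1
  rw [e1, e2, e3, e4, e5, o1, o2, o3, o4] at k2
  rw [g2Mixed, g2Square]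
  exact ⟨by linear_combination -k1, by linear_combination -k2⟩

end GeneralizedDunkl

end

/-! ### Which roots lie in a plane, outside type G₂ -/

noncomputable section

namespace GeneralizedDunkl

variable {ι V N : Type*} [NormedAddCommGroup V] [InnerProductSpace ℝ V]
  [AddCommGroup N] [Module ℝ N] {P : RootPairing ι ℝ V N} {i j : ι}

theorem linearIndependent_root_pair_iff [P.IsReduced] : LinearIndependent ℝ ![P.root i, P.root j] ↔
    P.root i ≠ P.root j ∧ P.root i ≠ -P.root j := by
  constructor
  · intro h
    refine ⟨fun h0 ↦ ?_, fun h0 ↦ ?_⟩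
    · have := LinearIndependent.pair_iff.mp h 1 (-1) (by rw [h0]; module)
      exact one_ne_zero this.1
    · have := LinearIndependent.pair_iff.mp h 1 1 (by rw [h0]; module)
      exact one_ne_zero this.1
  · rintro ⟨h1, h2⟩
    by_contra h
    exact (RootPairing.IsReduced.eq_or_eq_neg i j h).elim h1 h2

theorem linearIndependent_of_notMem_span [P.IsReduced] {a : V}
    (hj : P.root j ∉ Submodule.span ℝ {P.root i, a}) :
    LinearIndependent ℝ ![P.root i, P.root j] := by
  have hi : P.root i ∈ Submodule.span ℝ {P.root i, a} := Submodule.subset_span (by simp)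
  rw [linearIndependent_root_pair_iff]
  refine ⟨fun h ↦ hj (h ▸ hi), fun h ↦ hj ?_⟩
  rw [← neg_neg (P.root j), ← h]
  exact Submodule.neg_mem _ hi

theorem IsOrthogonal.inner_root_self_eq (hP : IsOrthogonal P) {κ κ' : ℝ}
    (hκ : P.pairing i j = κ) (hκ' : P.pairing j i = κ') :
    κ' * inner ℝ (P.root i) (P.root i) = 2 * inner ℝ (P.root i) (P.root j) ∧
      κ * inner ℝ (P.root j) (P.root j) = 2 * inner ℝ (P.root i) (P.root j) := by
  rw [← hκ, ← hκ', hP.pairing_mul_inner_self, hP.pairing_mul_inner_self,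
    real_inner_comm (P.root i) (P.root j)]
  exact ⟨rfl, rfl⟩

/-- The inner product as an invariant form. -/
def IsOrthogonal.invariantForm (hP : IsOrthogonal P) : P.InvariantForm where
  form := innerₗ V
  symm := ⟨fun x y ↦ real_inner_comm y x⟩
  ne_zero i := (inner_root_self_pos P i).ne'
  isOrthogonal_reflection i := hP i

/-- The product of the two pairings is `4 cos² θ`; without G₂ it is at most `2`, so distinct lines
of roots meet at an angle of at least `π/4`. -/
theorem IsOrthogonal.two_mul_inner_sq_le [Finite ι] [P.IsNotG2] (hP : IsOrthogonal P)
    (h : LinearIndependent ℝ ![P.root i, P.root j]) :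
    2 * inner ℝ (P.root i) (P.root j) ^ 2 ≤
      inner ℝ (P.root i) (P.root i) * inner ℝ (P.root j) (P.root j) := by
  obtain ⟨h1, h2⟩ := linearIndependent_root_pair_iff.mp h
  have h3 := P.pairingIn_pairingIn_mem_set_of_isCrystal_of_isRed' i j h1 h2
  have h4 := RootPairing.IsNotG2.pairingIn_mem_zero_one_two (P := P) i j
  have h5 := RootPairing.IsNotG2.pairingIn_mem_zero_one_two (P := P) j i
  have h6 : P.pairingIn ℤ i j * P.pairingIn ℤ j i ≤ 2 := by
    generalize P.pairingIn ℤ i j = x, P.pairingIn ℤ j i = y at h3 h4 h5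
    simp only [Set.mem_insert_iff, Set.mem_singleton_iff, Prod.mk.injEq] at h3 h4 h5
    rcases h3 with h | h | h | h | h | h | h | h | h | h | h <;> obtain ⟨rfl, rfl⟩ := h <;>
      revert h4 h5 <;> norm_num
  have h7 : P.pairing i j * P.pairing j i ≤ 2 := by
    rw [← P.algebraMap_pairingIn ℤ i j, ← P.algebraMap_pairingIn ℤ j i, eq_intCast, eq_intCast]
    exact_mod_cast h6
  obtain ⟨h8, h9⟩ := hP.inner_root_self_eq (i := i) (j := j) rfl rfl
  have h10 := mul_le_mul_of_nonneg_right h7 (mul_nonneg (inner_root_self_pos P i).le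
    (inner_root_self_pos P j).le)
  have h11 : P.pairing i j * P.pairing j i *
      (inner ℝ (P.root i) (P.root i) * inner ℝ (P.root j) (P.root j)) =
        4 * inner ℝ (P.root i) (P.root j) ^ 2 := by
    linear_combination (P.pairing i j * inner ℝ (P.root j) (P.root j)) * h8 +
      2 * inner ℝ (P.root i) (P.root j) * h9
  linarith

/-- In a root system which is not of type `G₂`, two distinct non-orthogonal lines of roots contain
roots whose pairings are `1` and `1` or `2`. -/
theorem IsOrthogonal.exists_pairing_eq [Finite ι] [P.IsNotG2] (hP : IsOrthogonal P)
    (h : LinearIndependent ℝ ![P.root i, P.root j]) (h0 : inner ℝ (P.root i) (P.root j) ≠ 0) :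
    ∃ k, (k = j ∨ k = P.reflectionPerm j j) ∧ (P.pairing i k = 1 ∧ P.pairing k i = 1 ∨
      P.pairing i k = 1 ∧ P.pairing k i = 2 ∨ P.pairing i k = 2 ∧ P.pairing k i = 1) := by
  obtain ⟨h1, h2⟩ := linearIndependent_root_pair_iff.mp h
  have h3 := P.pairingIn_pairingIn_mem_set_of_isCrystal_of_isRed' i j h1 h2
  have h4 := RootPairing.IsNotG2.pairingIn_mem_zero_one_two (P := P) i j
  have h5 := RootPairing.IsNotG2.pairingIn_mem_zero_one_two (P := P) j i
  have h6 : P.pairing i j ≠ 0 := fun h ↦ h0 (by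
    have := hP.pairing_mul_inner_self i j
    rw [h] at this
    linarith)
  have e1 := P.algebraMap_pairingIn ℤ i j
  have e2 := P.algebraMap_pairingIn ℤ j i
  rw [eq_intCast] at e1 e2
  have n1 : P.pairing i (P.reflectionPerm j j) = -P.pairing i j :=
    P.pairing_reflectionPerm_self_right i j
  have n2 : P.pairing (P.reflectionPerm j j) i = -P.pairing j i :=
    P.pairing_reflectionPerm_self_left j i
  rw [← e1] at n1 h6
  rw [← e2] at n2
  simp only [exists_eq_left, ← e1, ← e2, or_and_right, exists_or, n1, n2]
  generalize P.pairingIn ℤ i j = x, P.pairingIn ℤ j i = y at *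
  simp only [Set.mem_insert_iff, Set.mem_singleton_iff, Prod.mk.injEq] at h3 h4 h5
  rcases h3 with h | h | h | h | h | h | h | h | h | h | h <;> obtain ⟨rfl, rfl⟩ := h <;>
    revert h4 h5 h6 <;> norm_num

theorem inner_smul_add_smul (a b : V) (x y c d : ℝ) :
    inner ℝ (x • a + y • b) (c • a + d • b) = x * c * inner ℝ a a +
      (x * d + y * c) * inner ℝ a b + y * d * inner ℝ b b := by
  simp only [inner_add_left, inner_add_right, real_inner_smul_left, real_inner_smul_right,
    real_inner_comm a b]
  ring

/-- A further root would make an angle of at least `π/4` with every line of the sequence. The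
hypothesis `hq` says, in coordinates and after division by `(α_i, α_i)²`, that only the zero vector
does so. -/
theorem IsOrthogonal.exists_eq_of_mem_span [Finite ι] [P.IsNotG2] (hP : IsOrthogonal P) {κ' : ℝ}
    (hκ : P.pairing i j = 1) (hκ' : P.pairing j i = κ') {n : ℕ}
    (hq : ∀ x y : ℝ, (∀ k < n, ∀ c d, c = rotationCoeff 1 κ' 1 0 k → d = rotationCoeff 1 κ' 0 1 k →
      2 * (x * c + κ' / 2 * (x * d + y * c) + κ' * (y * d)) ^ 2 ≤
        (x ^ 2 + κ' * (x * y) + κ' * y ^ 2) * (c ^ 2 + κ' * (c * d) + κ' * d ^ 2)) →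
      x = 0 ∧ y = 0) (l : ι) (hl : P.root l ∈ Submodule.span ℝ {P.root i, P.root j}) :
    ∃ k < n, P.root l = rotationCoeff 1 κ' 1 0 k • P.root i + rotationCoeff 1 κ' 0 1 k • P.root j ∨
      P.root l = -(rotationCoeff 1 κ' 1 0 k • P.root i + rotationCoeff 1 κ' 0 1 k • P.root j) := by
  obtain ⟨x, y, hxy⟩ := Submodule.mem_span_pair.mp hl
  by_contra hcon
  push Not at hcon
  obtain ⟨hx, hy⟩ := hq x y fun k hk c d hc hd ↦ by
    have hr : P.root (rotationSeq P i j k) = c • P.root i + d • P.root j := by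
      rw [hc, hd]
      exact root_rotationSeq hκ hκ' (by simp) (by simp) k
    have h1 := hP.two_mul_inner_sq_le (i := l) (j := rotationSeq P i j k)
      (linearIndependent_root_pair_iff.mpr (by rw [hr, hc, hd]; exact hcon k hk))
    rw [hr, ← hxy, inner_smul_add_smul, inner_smul_add_smul, inner_smul_add_smul] at h1
    obtain ⟨h2, h3⟩ := hP.inner_root_self_eq hκ hκ'
    have hA := inner_root_self_pos P i
    have hab : inner ℝ (P.root i) (P.root j) = κ' / 2 * inner ℝ (P.root i) (P.root i) := by linarith
    have hbb : inner ℝ (P.root j) (P.root j) = κ' * inner ℝ (P.root i) (P.root i) := by linarith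
    rw [hbb, hab] at h1
    generalize inner ℝ (P.root i) (P.root i) = A at hA h1
    refine le_of_mul_le_mul_right ?_ (pow_pos hA 2)
    linarith
  apply P.ne_zero l
  rw [← hxy, hx, hy, zero_smul, zero_smul, add_zero]

theorem IsOrthogonal.exists_eq_of_mem_span_A₂ [Finite ι] [P.IsNotG2] (hP : IsOrthogonal P)
    (hκ : P.pairing i j = 1) (hκ' : P.pairing j i = 1) (l : ι)
    (hl : P.root l ∈ Submodule.span ℝ {P.root i, P.root j}) :
    ∃ k < 3, P.root l = rotationCoeff 1 1 1 0 k • P.root i + rotationCoeff 1 1 0 1 k • P.root j ∨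
      P.root l = -(rotationCoeff 1 1 1 0 k • P.root i + rotationCoeff 1 1 0 1 k • P.root j) := by
  refine hP.exists_eq_of_mem_span hκ hκ' (fun x y h ↦ ?_) l hl
  have h0 := h 0 (by norm_num) 1 0 (by norm_num [rotationCoeff]) (by norm_num [rotationCoeff])
  have h1 := h 1 (by norm_num) 0 1 (by norm_num [rotationCoeff]) (by norm_num [rotationCoeff])
  have h2 := h 2 (by norm_num) (-1) 1 (by norm_num [rotationCoeff]) (by norm_num [rotationCoeff])
  -- The three inequalities add up to `0 ≤ 0`, so each is an equality.
  have e : x ^ 2 - y ^ 2 = 0 := by nlinarith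
  have e2 : x ^ 2 + 4 * x * y + y ^ 2 = 0 := by nlinarith
  rcases mul_eq_zero.mp (show (x - y) * (x + y) = 0 by linarith) with h3 | h3
  · obtain rfl : x = y := by linarith
    have : x ^ 2 = 0 := by linarith
    have := pow_eq_zero_iff (two_ne_zero) |>.mp this
    exact ⟨this, this⟩
  · obtain rfl : x = -y := by linarith
    have : y ^ 2 = 0 := by linarith
    have := pow_eq_zero_iff (two_ne_zero) |>.mp this
    exact ⟨by simp [this], this⟩

theorem IsOrthogonal.exists_eq_of_mem_span_B₂ [Finite ι] [P.IsNotG2] (hP : IsOrthogonal P)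
    (hκ : P.pairing i j = 1) (hκ' : P.pairing j i = 2) (l : ι)
    (hl : P.root l ∈ Submodule.span ℝ {P.root i, P.root j}) :
    ∃ k < 4, P.root l = rotationCoeff 1 2 1 0 k • P.root i + rotationCoeff 1 2 0 1 k • P.root j ∨
      P.root l = -(rotationCoeff 1 2 1 0 k • P.root i + rotationCoeff 1 2 0 1 k • P.root j) := by
  refine hP.exists_eq_of_mem_span hκ hκ' (fun x y h ↦ ?_) l hl
  have h0 := h 0 (by norm_num) 1 0 (by norm_num [rotationCoeff]) (by norm_num [rotationCoeff])
  have h1 := h 1 (by norm_num) 0 1 (by norm_num [rotationCoeff]) (by norm_num [rotationCoeff])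
  have h2 := h 2 (by norm_num) (-1) 1 (by norm_num [rotationCoeff]) (by norm_num [rotationCoeff])
  have h3 := h 3 (by norm_num) (-2) 1 (by norm_num [rotationCoeff]) (by norm_num [rotationCoeff])
  norm_num at h0 h1 h2 h3
  -- With `p = x + y` and `q = y`, coordinates along two orthogonal short roots, the inequalities
  -- say `p² = q²` and `p q = 0`.
  have hy : y ^ 2 = 0 := by nlinarith [sq_nonneg (x + y), sq_nonneg y]
  have hx : (x + y) ^ 2 = 0 := by nlinarith [sq_nonneg (x + y), sq_nonneg y]
  have hy := pow_eq_zero_iff (two_ne_zero) |>.mp hy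
  have hx := pow_eq_zero_iff (two_ne_zero) |>.mp hx
  exact ⟨by linarith, hy⟩

/-- The orthogonal pair consists of the short root `α_i` and the short root `α_j - α_i`. -/
theorem IsOrthogonal.isTypeB₂_of_span_eq_top [Finite ι] [P.IsNotG2] (hP : IsOrthogonal P)
    (hκ : P.pairing i j = 1) (hκ' : P.pairing j i = 2)
    (hs : Submodule.span ℝ {P.root i, P.root j} = ⊤) : IsTypeB₂ P := by
  obtain ⟨h2, h3⟩ := hP.inner_root_self_eq hκ hκ'
  refine ⟨P.root i, P.root j - P.root i, ?_, ?_, ?_⟩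
  · rw [inner_sub_right]
    linarith
  · refine (sq_eq_sq₀ (norm_nonneg _) (norm_nonneg _)).mp ?_
    rw [← real_inner_self_eq_norm_sq, ← real_inner_self_eq_norm_sq, inner_sub_left,
      inner_sub_right, inner_sub_right, real_inner_comm (P.root i) (P.root j)]
    linarith
  · have hseq (k : ℕ) : P.root (rotationSeq P i j k) =
        rotationCoeff 1 2 1 0 k • P.root i + rotationCoeff 1 2 0 1 k • P.root j :=
      root_rotationSeq hκ hκ' (by simp) (by simp) k
    apply Set.Subset.antisymm
    · rintro _ ⟨l, rfl⟩
      obtain ⟨k, hk, h⟩ := hP.exists_eq_of_mem_span_B₂ hκ hκ' l (hs ▸ Submodule.mem_top)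
      generalize P.root l = v at h
      simp only [Set.mem_insert_iff, Set.mem_singleton_iff]
      interval_cases k <;> norm_num [rotationCoeff] at h <;> rcases h with rfl | rfl
      · simp
      · simp
      · right; right; right; right; left; abel
      · right; right; right; right; right; left; abel
      · right; right; left; abel
      · right; right; right; left; abel
      · right; right; right; right; right; right; right; module
      · right; right; right; right; right; right; left; module
    · have hneg {v : V} (hv : v ∈ Set.range P.root) : -v ∈ Set.range P.root := by
        obtain ⟨l, rfl⟩ := hv
        exact ⟨_, root_reflectionPerm_self l⟩
      have m1 : P.root i ∈ Set.range P.root := ⟨i, rfl⟩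
      have m2 : P.root i + (P.root j - P.root i) ∈ Set.range P.root := ⟨j, by abel⟩
      have m3 : P.root j - P.root i ∈ Set.range P.root := ⟨_, (hseq 2).trans (by
        norm_num [rotationCoeff]; abel)⟩
      have m4 : -P.root i + (P.root j - P.root i) ∈ Set.range P.root := ⟨_, (hseq 3).trans (by
        norm_num [rotationCoeff]; module)⟩
      rintro v hv
      simp only [Set.mem_insert_iff, Set.mem_singleton_iff] at hv
      rcases hv with rfl | rfl | rfl | rfl | rfl | rfl | rfl | rfl
      · exact m1
      · exact hneg m1
      · exact m3
      · exact hneg m3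
      · exact m2
      · convert hneg m2 using 1; abel
      · convert hneg m4 using 1; abel
      · exact m4

theorem isTypeA₁_of_span_eq_top [P.IsReduced] (hs : Submodule.span ℝ {P.root i} = ⊤) :
    IsTypeA₁ P := by
  refine ⟨P.root i, Set.Subset.antisymm ?_ ?_⟩
  · rintro _ ⟨j, rfl⟩
    by_contra h
    have hli : LinearIndependent ℝ ![P.root j, P.root i] := by
      rw [linearIndependent_root_pair_iff]
      simpa using h
    obtain ⟨c, hc⟩ := Submodule.mem_span_singleton.mp (hs ▸ Submodule.mem_top : P.root j ∈ _)
    have := LinearIndependent.pair_iff.mp hli 1 (-c) (by rw [← hc]; module)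
    exact one_ne_zero this.1
  · rintro v (rfl | rfl)
    · exact ⟨i, rfl⟩
    · exact ⟨_, root_reflectionPerm_self i⟩

end GeneralizedDunkl

end

/-! ### From planes to irreducible root systems -/

noncomputable section

namespace GeneralizedDunkl

variable {ι V N : Type*} [Fintype ι] [NormedAddCommGroup V] [InnerProductSpace ℝ V]
  [AddCommGroup N] [Module ℝ N] {P : RootPairing ι ℝ V N} {ℓ : V →ₗ[ℝ] ℝ} {φ : ι → ℝ → ℂ}
  {i j k : ι}

theorem IsInvariantSolution.isMultipleOfInv_reflectionPerm_iff (h : IsInvariantSolution P ℓ φ) :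
    IsMultipleOfInv (φ (P.reflectionPerm i j)) ↔ IsMultipleOfInv (φ j) :=
  ⟨fun h1 ↦ h1.congr ((h.invariant i j).mono fun _ ht ↦ ht.symm), fun h1 ↦ h1.congr (h.invariant i j)⟩

section IsNotG2

variable [P.IsNotG2]

/-- Equal lengths exclude the pairings `1` and `2`, so the plane has type A₂. -/
theorem IsInvariantSolution.isMultipleOfInv_of_norm_eq (h : IsInvariantSolution P ℓ φ)
    (hP : IsOrthogonal P) (hℓ : ∀ i, ℓ (P.root i) ≠ 0) (hF : ∀ i, MeromorphicAt (φ i) 0)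
    (hF0 : ∀ i, ¬ ∀ᶠ t in 𝓝[≠] (0 : ℝ), φ i t = 0)
    (hli : LinearIndependent ℝ ![P.root i, P.root j]) (h0 : inner ℝ (P.root i) (P.root j) ≠ 0)
    (hlen : inner ℝ (P.root i) (P.root i) = inner ℝ (P.root j) (P.root j)) :
    IsMultipleOfInv (φ i) := by
  obtain ⟨k, hk, hp⟩ := hP.exists_pairing_eq hli h0
  have hr : P.root k = P.root j ∨ P.root k = -P.root j := by
    rcases hk with rfl | rfl
    · exact Or.inl rfl
    · exact Or.inr (root_reflectionPerm_self j)
  have hlen' : inner ℝ (P.root i) (P.root i) = inner ℝ (P.root k) (P.root k) := by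
    rcases hr with hr | hr <;> rw [hr, hlen]
    rw [inner_neg_neg]
  have hli' : LinearIndependent ℝ ![P.root i, P.root k] := by
    rw [linearIndependent_root_pair_iff] at hli ⊢
    rcases hr with hr | hr <;> rw [hr]
    · exact hli
    · rw [neg_neg]
      exact hli.symm
  have hpos := inner_root_self_pos P k
  rcases hp with ⟨h1, h2⟩ | ⟨h1, h2⟩ | ⟨h1, h2⟩
  · exact h.isMultipleOfInv_of_simplyLaced hP hℓ h1 h2 hli' (hP.exists_eq_of_mem_span_A₂ h1 h2)
      (hF i) (hF0 i)
  all_goals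
    obtain ⟨h3, h4⟩ := hP.inner_root_self_eq h1 h2
    rw [hlen'] at h3
    linarith

theorem IsInvariantSolution.isMultipleOfInv_of_isMultipleOfInv (h : IsInvariantSolution P ℓ φ)
    (hP : IsOrthogonal P) (hℓ : ∀ i, ℓ (P.root i) ≠ 0) (hF : ∀ i, MeromorphicAt (φ i) 0)
    (hF0 : ∀ i, ¬ ∀ᶠ t in 𝓝[≠] (0 : ℝ), φ i t = 0)
    (hli : LinearIndependent ℝ ![P.root i, P.root j]) (h0 : inner ℝ (P.root i) (P.root j) ≠ 0)
    (hj : IsMultipleOfInv (φ j)) : IsMultipleOfInv (φ i) := by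
  obtain ⟨k, hk, hp⟩ := hP.exists_pairing_eq hli h0
  have hk' : IsMultipleOfInv (φ k) := by
    rcases hk with rfl | rfl
    · exact hj
    · exact h.isMultipleOfInv_reflectionPerm_iff.mpr hj
  have hli' : LinearIndependent ℝ ![P.root i, P.root k] := by
    rw [linearIndependent_root_pair_iff] at hli ⊢
    rcases hk with rfl | rfl
    · exact hli
    · rw [root_reflectionPerm_self, neg_neg]
      exact hli.symm
  rcases hp with ⟨h1, h2⟩ | ⟨h1, h2⟩ | ⟨h1, h2⟩
  · exact h.isMultipleOfInv_of_simplyLaced hP hℓ h1 h2 hli' (hP.exists_eq_of_mem_span_A₂ h1 h2)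
      (hF i) (hF0 i)
  · exact (h.isMultipleOfInv_long_iff_short hP hℓ h1 h2 hli' (hP.exists_eq_of_mem_span_B₂ h1 h2)
      hF hF0).mp hk'
  · exact (h.isMultipleOfInv_long_iff_short hP hℓ h2 h1 (LinearIndependent.pair_symm_iff.mp hli')
      (hP.exists_eq_of_mem_span_B₂ h2 h1) hF hF0).mpr hk'

/-- If the claim failed, `α_j` and `α_k` would both differ in length from `α_i`, hence have equal
length, as only two lengths occur. If they are not orthogonal they span an A₂ plane; if they are,
replace `α_j` by `s_i α_j`, which is not orthogonal to `α_k`. Either way `φ j` is a multiple of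
`1/t`, and this passes to `φ i`. -/
theorem IsInvariantSolution.isMultipleOfInv_of_notMem_span (h : IsInvariantSolution P ℓ φ)
    (hP : IsOrthogonal P) (hℓ : ∀ i, ℓ (P.root i) ≠ 0) (hF : ∀ i, MeromorphicAt (φ i) 0)
    (hF0 : ∀ i, ¬ ∀ᶠ t in 𝓝[≠] (0 : ℝ), φ i t = 0)
    (hli : LinearIndependent ℝ ![P.root i, P.root j]) (hij : inner ℝ (P.root i) (P.root j) ≠ 0)
    (hk : P.root k ∉ Submodule.span ℝ {P.root i, P.root j})
    (hik : inner ℝ (P.root i) (P.root k) ≠ 0) : IsMultipleOfInv (φ i) := by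
  by_contra hi
  have hlik := linearIndependent_of_notMem_span hk
  have hljk : LinearIndependent ℝ ![P.root j, P.root k] :=
    linearIndependent_of_notMem_span (a := P.root i) (by rwa [Set.pair_comm])
  have h1 : inner ℝ (P.root i) (P.root i) ≠ inner ℝ (P.root j) (P.root j) := fun h2 ↦
    hi (h.isMultipleOfInv_of_norm_eq hP hℓ hF hF0 hli hij h2)
  have h2 : inner ℝ (P.root k) (P.root k) = inner ℝ (P.root j) (P.root j) :=
    (hP.invariantForm.apply_eq_or_of_apply_ne h1 k).resolve_left fun h2 ↦
      hi (h.isMultipleOfInv_of_norm_eq hP hℓ hF hF0 hlik hik h2.symm)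
  refine hi (h.isMultipleOfInv_of_isMultipleOfInv hP hℓ hF hF0 hli hij ?_)
  by_cases hjk : inner ℝ (P.root j) (P.root k) = 0
  · rw [← h.isMultipleOfInv_reflectionPerm_iff (i := i)]
    have hr : P.root (P.reflectionPerm i j) = P.root j - P.pairing j i • P.root i := by
      rw [P.root_reflectionPerm, P.reflection_apply_root]
    refine h.isMultipleOfInv_of_norm_eq hP hℓ hF hF0 (j := k) ?_ ?_ ?_
    · rw [linearIndependent_root_pair_iff, hr]
      refine ⟨fun h3 ↦ hk ?_, fun h3 ↦ hk ?_⟩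
      · rw [← h3]
        exact Submodule.mem_span_pair.mpr ⟨-P.pairing j i, 1, by module⟩
      · rw [← neg_neg (P.root k), ← h3]
        exact Submodule.mem_span_pair.mpr ⟨P.pairing j i, -1, by module⟩
    · rw [hr, inner_sub_left, real_inner_smul_left, hjk, zero_sub, neg_ne_zero]
      refine mul_ne_zero (fun h3 ↦ hij ?_) hik
      have := hP.pairing_mul_inner_self j i
      rw [h3, real_inner_comm (P.root i) (P.root j)] at this
      linarith
    · rw [P.root_reflectionPerm, hP, h2]
  · exact h.isMultipleOfInv_of_norm_eq hP hℓ hF hF0 hljk hjk h2.symm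

/-- Irreducibility enters twice: not being A₁ gives a non-orthogonal root off the line of `α_i`, and
a failure at `α_i` makes every root outside their plane orthogonal to both, so the plane is
everything. -/
theorem IsInvariantSolution.isMultipleOfInv_of_isNotG2 (h : IsInvariantSolution P ℓ φ)
    (hP : IsOrthogonal P) (hℓ : ∀ i, ℓ (P.root i) ≠ 0) (hF : ∀ i, MeromorphicAt (φ i) 0)
    (hF0 : ∀ i, ¬ ∀ᶠ t in 𝓝[≠] (0 : ℝ), φ i t = 0)
    (hA₁ : ¬ IsTypeA₁ P) (hB₂ : ¬ IsTypeB₂ P) (i : ι) : IsMultipleOfInv (φ i) := by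
  have horth {i j : ι} (h0 : inner ℝ (P.root i) (P.root j) = 0) : P.IsOrthogonal j i := by
    have h1 := hP.pairing_mul_inner_self i j
    have h2 := hP.pairing_mul_inner_self j i
    rw [h0, mul_zero] at h1
    rw [real_inner_comm (P.root i) (P.root j), h0, mul_zero] at h2
    exact ⟨(mul_eq_zero.mp h2).resolve_right (inner_root_self_pos P i).ne',
      (mul_eq_zero.mp h1).resolve_right (inner_root_self_pos P j).ne'⟩
  have hA := P.span_root_image_eq_top_of_forall_orthogonal {i} (by simp)
  rw [Set.image_singleton] at hA
  have hA := mt hA (mt isTypeA₁_of_span_eq_top hA₁)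
  push Not at hA
  obtain ⟨j, hj, _, rfl, hij⟩ := hA
  rename_i i
  have hij : inner ℝ (P.root i) (P.root j) ≠ 0 := mt horth hij
  have hli : LinearIndependent ℝ ![P.root i, P.root j] :=
    linearIndependent_of_notMem_span (a := P.root i) (by simpa using hj)
  by_contra hi
  have hj' : ¬ IsMultipleOfInv (φ j) :=
    mt (h.isMultipleOfInv_of_isMultipleOfInv hP hℓ hF hF0 hli hij) hi
  have htop : Submodule.span ℝ {P.root i, P.root j} = ⊤ := by
    have hB := P.span_root_image_eq_top_of_forall_orthogonal {i, j} (by simp)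
    rw [Set.image_pair] at hB
    refine hB fun k hk l hl ↦ horth ?_
    by_contra hkl
    rcases hl with rfl | rfl
    · exact hi (h.isMultipleOfInv_of_notMem_span hP hℓ hF hF0 hli hij hk hkl)
    · exact hj' (h.isMultipleOfInv_of_notMem_span hP hℓ hF hF0
        (LinearIndependent.pair_symm_iff.mp hli) (by rwa [real_inner_comm])
        (by rwa [Set.pair_comm]) hkl)
  obtain ⟨k, hk, hp⟩ := hP.exists_pairing_eq hli hij
  have htop' : Submodule.span ℝ {P.root i, P.root k} = ⊤ := by
    rcases hk with rfl | rfl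
    · exact htop
    · rw [root_reflectionPerm_self, Submodule.span_insert, ← neg_one_smul ℝ (P.root j),
        Submodule.span_singleton_smul_eq isUnit_one.neg, ← Submodule.span_insert, htop]
  have hli' : LinearIndependent ℝ ![P.root i, P.root k] := by
    rw [linearIndependent_root_pair_iff] at hli ⊢
    rcases hk with rfl | rfl
    · exact hli
    · rw [root_reflectionPerm_self, neg_neg]
      exact hli.symm
  rcases hp with ⟨h1, h2⟩ | ⟨h1, h2⟩ | ⟨h1, h2⟩
  · exact hi (h.isMultipleOfInv_of_simplyLaced hP hℓ h1 h2 hli' (hP.exists_eq_of_mem_span_A₂ h1 h2)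
      (hF i) (hF0 i))
  · exact hB₂ (hP.isTypeB₂_of_span_eq_top h1 h2 htop')
  · exact hB₂ (hP.isTypeB₂_of_span_eq_top h2 h1 (by rwa [Set.pair_comm]))

end IsNotG2

open RootPairing.EmbeddedG2 in
theorem IsInvariantSolution.isMultipleOfInv_of_embeddedG2 [P.IsRootSystem] [P.IsIrreducible]
    [P.EmbeddedG2]
    (h : IsInvariantSolution P ℓ φ) (hP : IsOrthogonal P) (hℓ : ∀ i, ℓ (P.root i) ≠ 0)
    (hF : ∀ i, MeromorphicAt (φ i) 0) (hF0 : ∀ i, ¬ ∀ᶠ t in 𝓝[≠] (0 : ℝ), φ i t = 0) (i : ι) :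
    IsMultipleOfInv (φ i) := by
  set a := short P
  -- The two base roots of `EmbeddedG2` form an obtuse angle; negating the long one gives the
  -- pairings `1` and `3`.
  set b := P.reflectionPerm (long P) (long P)
  have hκ : P.pairing a b = 1 := by
    rw [P.pairing_reflectionPerm_self_right, pairing_short_long, neg_neg]
  have hκ' : P.pairing b a = 3 := by
    rw [P.pairing_reflectionPerm_self_left, pairing_long_short, neg_neg]
  have hlong : longRoot P = -P.root b := by rw [root_reflectionPerm_self, neg_neg]
  have hli : LinearIndependent ℝ ![P.root a, P.root b] := by
    have := linearIndependent_root_pair_iff.mp (linearIndependent_short_long P)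
    rw [linearIndependent_root_pair_iff, root_reflectionPerm_self, neg_neg]
    exact this.symm
  have hsol := h.solvesG2 hP hℓ hκ hκ' hli fun l _ ↦ by
    have hl := mem_allRoots P l
    simp only [allRoots, shortAddLongRoot_eq, twoShortAddLongRoot_eq, threeShortAddLongRoot_eq,
      threeShortAddTwoLongRoot_eq, hlong, List.mem_cons, List.not_mem_nil, or_false] at hl
    generalize P.root l = v at hl
    rcases hl with rfl | rfl | rfl | rfl | rfl | rfl | rfl | rfl | rfl | rfl | rfl | rfl
    · exact ⟨1, by norm_num, Or.inr (by norm_num [rotationCoeff])⟩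
    · exact ⟨1, by norm_num, Or.inl (by norm_num [rotationCoeff])⟩
    · exact ⟨0, by norm_num, Or.inl (by norm_num [rotationCoeff, a])⟩
    · exact ⟨0, by norm_num, Or.inr (by norm_num [rotationCoeff, a])⟩
    · exact ⟨2, by norm_num, Or.inr (by norm_num [rotationCoeff]; module)⟩
    · exact ⟨2, by norm_num, Or.inl (by norm_num [rotationCoeff]; module)⟩
    · exact ⟨4, by norm_num, Or.inr (by norm_num [rotationCoeff]; module)⟩
    · exact ⟨4, by norm_num, Or.inl (by norm_num [rotationCoeff]; module)⟩
    · exact ⟨5, by norm_num, Or.inr (by norm_num [rotationCoeff]; module)⟩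
    · exact ⟨5, by norm_num, Or.inl (by norm_num [rotationCoeff]; module)⟩
    · exact ⟨3, by norm_num, Or.inr (by norm_num [rotationCoeff]; module)⟩
    · exact ⟨3, by norm_num, Or.inl (by norm_num [rotationCoeff]; module)⟩
  obtain ⟨hgs, hgb⟩ := hsol.exists_eq_div (hF a) (hF b) (hF0 a) (hF0 b)
  have hgs : IsMultipleOfInv (φ (short P)) := hgs
  have hgl : IsMultipleOfInv (φ (long P)) := h.isMultipleOfInv_reflectionPerm_iff.mp hgb
  have hneg {l m : ι} (hm : IsMultipleOfInv (φ m)) (hlm : P.root l = P.root m ∨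
      P.root l = -P.root m) : IsMultipleOfInv (φ l) := by
    rcases hlm with hlm | hlm
    · rwa [P.root.injective hlm]
    · rw [P.root_eq_neg_iff.mp hlm]
      exact h.isMultipleOfInv_reflectionPerm_iff.mpr hm
  -- Up to sign, every root of G₂ is obtained from a base root by at most two reflections in base
  -- roots.
  have hi := mem_allRoots P i
  simp only [allRoots, List.mem_cons, List.not_mem_nil, or_false] at hi
  have r {l m : ι} := h.isMultipleOfInv_reflectionPerm_iff (i := l) (j := m)
  rcases hi with hi | hi | hi | hi | hi | hi | hi | hi | hi | hi | hi | hi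
  · exact hneg hgl (Or.inl hi)
  · exact hneg hgl (Or.inr hi)
  · exact hneg hgs (Or.inl hi)
  · exact hneg hgs (Or.inr hi)
  · exact hneg (r.mpr hgs) (Or.inl hi)
  · exact hneg (r.mpr hgs) (Or.inr hi)
  · exact hneg (r.mpr (r.mpr hgs)) (Or.inl hi)
  · exact hneg (r.mpr (r.mpr hgs)) (Or.inr hi)
  · exact hneg (r.mpr hgl) (Or.inl hi)
  · exact hneg (r.mpr hgl) (Or.inr hi)
  · exact hneg (r.mpr (r.mpr hgl)) (Or.inl hi)
  · exact hneg (r.mpr (r.mpr hgl)) (Or.inr hi)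

/-- A solution of the functional equations consists of multiples of `1 / t`, unless the root system
has type `A₁` or `B₂`. -/
theorem IsInvariantSolution.isMultipleOfInv [P.IsRootSystem] [P.IsCrystallographic] [P.IsReduced]
    [P.IsIrreducible] (h : IsInvariantSolution P ℓ φ)
    (hP : IsOrthogonal P) (hℓ : ∀ i, ℓ (P.root i) ≠ 0) (hF : ∀ i, MeromorphicAt (φ i) 0)
    (hF0 : ∀ i, ¬ ∀ᶠ t in 𝓝[≠] (0 : ℝ), φ i t = 0)
    (hA₁ : ¬ IsTypeA₁ P) (hB₂ : ¬ IsTypeB₂ P) (i : ι) : IsMultipleOfInv (φ i) := by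
  by_cases hG : P.IsG2
  · have := RootPairing.IsG2.toEmbeddedG2 (P := P)
    exact h.isMultipleOfInv_of_embeddedG2 hP hℓ hF hF0 i
  · have := P.not_isG2_iff_isNotG2.mp hG
    exact h.isMultipleOfInv_of_isNotG2 hP hℓ hF hF0 hA₁ hB₂ i

end GeneralizedDunkl

end

/-! ### From real germs back to meromorphic functions on `U` -/

theorem tendsto_ofReal_nhdsNE : Tendsto (fun t : ℝ ↦ (t : ℂ)) (𝓝[≠] 0) (𝓝[≠] 0) := by
  refine tendsto_nhdsWithin_of_tendsto_nhds_of_eventually_within _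
    ((Complex.continuous_ofReal.tendsto' 0 0 Complex.ofReal_zero).mono_left nhdsWithin_le_nhds) ?_
  filter_upwards [self_mem_nhdsWithin] with t ht
  simpa using ht

theorem MeromorphicAt.comp_ofReal {g : ℂ → ℂ} (hg : MeromorphicAt g 0) :
    MeromorphicAt (fun t : ℝ ↦ g t) 0 := by
  obtain ⟨n, hn⟩ := hg
  refine ⟨n, ?_⟩
  have hn' : AnalyticAt ℝ (fun z : ℂ ↦ (z - 0) ^ n • g z) (Complex.ofRealCLM 0) := by
    rw [map_zero]
    exact hn.restrictScalars
  refine (hn'.comp (Complex.ofRealCLM.analyticAt 0)).congr (Eventually.of_forall fun t ↦ ?_)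
  simp [Complex.real_smul]

theorem Filter.EventuallyEq.eventually_nhdsNE_of_codiscreteWithin {g h : ℂ → ℂ} {U : Set ℂ}
    (hU : IsOpen U) {x : ℂ} (hx : x ∈ U) (hgh : g =ᶠ[codiscreteWithin U] h) :
    ∀ᶠ z in 𝓝[≠] x, g z = h z := by
  have h1 := mem_codiscreteWithin_iff_forall_mem_nhdsNE.mp hgh x hx
  filter_upwards [h1, (hU.mem_nhds hx |> mem_nhdsWithin_of_mem_nhds : U ∈ 𝓝[≠] x)] with z hz hzU
  exact hz.resolve_right fun hc ↦ hc hzU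

/-- A meromorphic function on a connected open neighbourhood of `0` which vanishes on the real
numbers near `0` vanishes. -/
theorem MeromorphicOn.eventuallyEq_zero_of_ofReal {g : ℂ → ℂ} {U : Set ℂ} (hg : MeromorphicOn g U)
    (hUc : IsConnected U) (hU0 : (0 : ℂ) ∈ U)
    (h0 : ∀ᶠ t : ℝ in 𝓝[≠] 0, g (t : ℂ) = 0) : g =ᶠ[codiscreteWithin U] 0 := by
  have hz : ∀ᶠ z in 𝓝[≠] (0 : ℂ), g z = 0 := by
    refine (hg 0 hU0).eventually_eq_zero_or_eventually_ne_zero.resolve_right fun hc ↦ ?_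
    have hc' : ∀ᶠ t in 𝓝[≠] (0 : ℝ), g (t : ℝ) ≠ 0 := tendsto_ofReal_nhdsNE.eventually hc
    obtain ⟨t, h1, h2⟩ := (h0.and hc').exists
    exact h2 h1
  refine mem_codiscreteWithin_iff_forall_mem_nhdsNE.mpr fun x hx ↦ ?_
  have hx' : meromorphicOrderAt g x = ⊤ := by
    by_contra hc
    exact hg.meromorphicOrderAt_ne_top_of_isPreconnected hUc.isPreconnected hx hU0 hc
      (meromorphicOrderAt_eq_top_iff.mpr hz)
  filter_upwards [meromorphicOrderAt_eq_top_iff.mp hx'] with z hz using Or.inl hz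

open GeneralizedDunkl in
theorem mainTheorem5 {ι V N : Type*} [Fintype ι] [NormedAddCommGroup V] [InnerProductSpace ℝ V]
    [AddCommGroup N] [Module ℝ N]
    (P : RootPairing ι ℝ V N) [P.IsRootSystem] [P.IsCrystallographic] [P.IsReduced]
    [P.IsIrreducible]
    (hP : GeneralizedDunkl.IsOrthogonal P)
    (hA₁ : ¬ GeneralizedDunkl.IsTypeA₁ P) (hB₂ : ¬ GeneralizedDunkl.IsTypeB₂ P)
    (ℓ : V →ₗ[ℝ] ℝ) (hℓ : ∀ i, ℓ (P.root i) ≠ 0)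
    (U : Set ℂ) (hU : IsOpen U) (hUc : IsConnected U) (hU0 : (0 : ℂ) ∈ U)
    (f : ι → ℂ → ℂ)
    (hmer : ∀ i, MeromorphicOn (f i) U)
    (hne : ∀ i, ¬ f i =ᶠ[codiscreteWithin U] 0)
    (hneg : ∀ i j, P.root j = -P.root i → ∀ᶠ z in 𝓝[≠] (0 : ℂ), f j z = -f i (-z))
    (hW : ∀ (w : P.weylGroup) (i : ι), f (P.weylGroupToPerm w i) =ᶠ[codiscreteWithin U] f i)
    (heq : GeneralizedDunkl.SolvesFunctionalEquations P ℓ f) :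
    ∃ k : ι → ℂ, (∀ (w : P.weylGroup) (i : ι), k (P.weylGroupToPerm w i) = k i) ∧
      ∀ i, f i =ᶠ[codiscreteWithin U] fun z ↦ k i / z := by
  have hreal (w : P.weylGroup) (i : ι) :
      ∀ᶠ t in 𝓝[≠] (0 : ℝ), f (P.weylGroupToPerm w i) (t : ℝ) = f i t :=
    tendsto_ofReal_nhdsNE.eventually ((hW w i).eventually_nhdsNE_of_codiscreteWithin hU hU0)
  have hinv (i j : ι) : ∀ᶠ t in 𝓝[≠] (0 : ℝ), f (P.reflectionPerm i j) (t : ℝ) = f j t := by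
    have h1 := hreal ⟨_, P.reflection_mem_weylGroup i⟩ j
    have h2 : P.weylGroupToPerm ⟨_, P.reflection_mem_weylGroup i⟩ = P.reflectionPerm i :=
      RootPairing.Equiv.reflection_indexEquiv P i
    rwa [h2] at h1
  have hsol : IsInvariantSolution P ℓ (fun i t ↦ f i (t : ℝ)) := by
    refine ⟨fun i ↦ ?_, hinv, heq⟩
    -- Oddness: the sign rule compares `f_{-α}` with `f_α`, and invariance under `s_α` identifies
    -- the two.
    have hn : ∀ᶠ t in 𝓝[≠] (0 : ℝ), f (P.reflectionPerm i i) (t : ℝ) = -f i (-(t : ℝ)) :=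
      tendsto_ofReal_nhdsNE.eventually
        (hneg i (P.reflectionPerm i i) (root_reflectionPerm_self i))
    filter_upwards [hn, hinv i i] with t h1 h2
    rw [Complex.ofReal_neg, ← h2, h1, neg_neg]
  have hgood := hsol.isMultipleOfInv hP hℓ (fun i ↦ (hmer i 0 hU0).comp_ofReal)
    (fun i h0 ↦ hne i ((hmer i).eventuallyEq_zero_of_ofReal hUc hU0 h0)) hA₁ hB₂
  choose k hk using hgood
  refine ⟨k, fun w i ↦ ?_, fun i ↦ ?_⟩
  · obtain ⟨t, h1, h2, h3, ht⟩ := ((hk (P.weylGroupToPerm w i)).and ((hk i).and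
      ((hreal w i).and self_mem_nhdsWithin))).exists
    have ht' : (t : ℂ) ≠ 0 := by exact_mod_cast ht
    beta_reduce at h1 h2
    rw [h3, h2] at h1
    exact ((div_left_inj' ht').mp h1).symm
  · have hd : MeromorphicOn (fun z : ℂ ↦ f i z - k i / z) U := fun z hz ↦
      (hmer i z hz).fun_sub ((MeromorphicAt.const _ _).fun_div (MeromorphicAt.id _))
    filter_upwards [hd.eventuallyEq_zero_of_ofReal hUc hU0 (by
      filter_upwards [hk i] with t ht
      rw [ht, sub_self])] with z hz
    exact sub_eq_zero.mp hz
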